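/- Let $q\ge 1$ and let $R$ be an irreducible symmetric $q\times q$ matrix with non-negative real coefficients. Consider labelled graphs $G$ with vertex set $\{1,\dots,n\}$ and $m$ edges (a multiset of $m$ unordered pairs of vertices; loops and multiple edges are allowed), in which each vertex $v$ has a type $t(v)\in\{1,\dots,q\}$. The weight of such a graph is $$\omega(G)=\kappa(G)\prod_{\{v,w\}\in G}R_{t(v),t(w)},\qquad \kappa(G)=\frac{\operatorname{seqv}(G)}{2^m m!},$$ where the product is over the edges with multiplicity and $\operatorname{seqv}(G)$ is the number of sequences $v_1w_1\cdots v_mw_m$ of vertices such that the multiset $\{\{v_i,w_i\} : 1\le i\le m\}$ is the multiset of edges of $G$. Let $G_{R,\mathbf 1}(n,m)$ be the sum of the weights of all these graphs (all vertex weights being $1$). Let $\mathcal S^\circ=\{x\in\mathbb R^q : x_i>0 \text{ for all } i,\ \sum_i x_i=1\}$, let $E$ be the $q\times(q-1)$ matrix whose first $q-1$ rows form the identity matrix and whose last row is $(-1,\dots,-1)$, and for real $c$ and $x\in\mathcal S^\circ$ put $$\mathcal H_{c}(x)=E^{\mathsf T}\Big(\operatorname{diag}(x)^{-1}+\frac{2c}{x^{\mathsf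 T}Rx}\Big(\frac{2}{x^{\mathsf T}Rx}\,Rx\,x^{\mathsf T}R-R\Big)\Big)E,$$ which is the Hessian at $\epsilon=0$ of $\epsilon\mapsto\Phi_c(x+E\epsilon)$ with $\Phi_c(x)=\sum_i x_i\log x_i-c\log(x^{\mathsf T}Rx)$. Let $$\beta=\sup\{c : \det\mathcal H_c(x)>0\ \text{ for all } x\in\mathcal S^\circ\}\in[0,+\infty].$$ Let $\lambda_1\ge\cdots\ge\lambda_q$ be the eigenvalues of $R$, counted with multiplicity, and assume that the all-ones vector is an eigenvector of $R$. 1. For every compact interval $[a,b]\subset\,]0,\beta[$, as $n\to\infty$, uniformly in $m$ with $\frac mn\in[a,b]$, $$G_{R,\mathbf 1}(n,m)\sim\frac{n^{2m}}{2^m m!}\,\lambda_1^m\,q^{n-m}\prod_{i=2}^q\Big(1-2\,\frac{\lambda_i}{\lambda_1}\,\frac mn\Big)^{-1/2}.$$ 2. If $q\ge2$ and $\lambda_2>0$, then $\beta\le\frac{\lambda_1}{2\lambda_2}$. 3. Otherwise (that is, if $q=1$ or $\lambda_2\le0$) the asymptotics of part 1 holds, uniformly, for $\frac mn$ in any compact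 interval of $\mathbb R_{>0}$. -/

import Mathlib

open scoped Matrix

noncomputable section

namespace InhomGraph

/-- A labelled graph with vertex set `Fin n`, in which every vertex has a type in `Fin q`, and with
`m` edges: a multiset of `m` unordered pairs of vertices (loops and multiple edges are allowed). -/
structure TypedGraph (q n m : ℕ) where
  type : Fin n → Fin q
  edges : Sym (Sym2 (Fin n)) m

/-- A typed graph is a pair (types, edges). -/
def TypedGraph.equivProd (q n m : ℕ) :
    TypedGraph q n m ≃ (Fin n → Fin q) × Sym (Sym2 (Fin n)) m where
  toFun G := (G.type, G.edges)
  invFun p := ⟨p.1, p.2⟩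
  left_inv _ := rfl
  right_inv _ := rfl

instance (q n m : ℕ) : Fintype (TypedGraph q n m) :=
  Fintype.ofEquiv _ (TypedGraph.equivProd q n m).symm

/-- The number of sequences of vertices `v₁ w₁ … v_m w_m` whose multiset of edges
`{v₁, w₁}, …, {v_m, w_m}` is `edges`. -/
def seqv {n m : ℕ} (edges : Sym (Sym2 (Fin n)) m) : ℕ :=
  Nat.card {p : Fin m → Fin n × Fin n //
    Finset.univ.val.map (fun i => s((p i).1, (p i).2)) = (edges : Multiset (Sym2 (Fin n)))}

/-- The compensation factor `κ = seqv / (2 ^ m * m!)`. -/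
def compensation {n m : ℕ} (edges : Sym (Sym2 (Fin n)) m) : ℝ :=
  (seqv edges : ℝ) / (2 ^ m * (m.factorial : ℝ))

/-- The weight `R_{t(v), t(w)}` of the edge `{v, w}`, where `t` gives the types of the vertices. -/
def edgeWeight {q n : ℕ} (R : Matrix (Fin q) (Fin q) ℝ) (hR : R.IsSymm) (t : Fin n → Fin q) :
    Sym2 (Fin n) → ℝ :=
  Sym2.lift ⟨fun v w => R (t v) (t w), fun v w => hR.apply (t w) (t v)⟩

/-- The weight of an `(R, r)`-graph: its compensation factor, times the weights of its vertices,
times the weights of its edges. -/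
def TypedGraph.weight {q n m : ℕ} (R : Matrix (Fin q) (Fin q) ℝ) (hR : R.IsSymm) (r : Fin q → ℝ)
    (G : TypedGraph q n m) : ℝ :=
  compensation G.edges * (∏ u, r (G.type u)) *
    ((G.edges : Multiset (Sym2 (Fin n))).map (edgeWeight R hR G.type)).prod

/-- `G_{R, r}(n, m)`: the number of `(R, r)`-graphs with `n` vertices and `m` edges, that is, the
sum of their weights. -/
def numGraphs {q : ℕ} (R : Matrix (Fin q) (Fin q) ℝ) (hR : R.IsSymm) (r : Fin q → ℝ)
    (n m : ℕ) : ℝ :=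
  ∑ G : TypedGraph q n m, G.weight R hR r

/-- The interior of the standard simplex. -/
def openSimplex (q : ℕ) : Set (Fin q → ℝ) :=
  {x | (∀ i, 0 < x i) ∧ ∑ i, x i = 1}

/-- The `q × (q - 1)` matrix with the identity as its first `q - 1` rows and with a last row
all of whose entries are `-1`. -/
def matE (q : ℕ) : Matrix (Fin q) (Fin (q - 1)) ℝ :=
  Matrix.of fun i j => if (i : ℕ) = j then 1 else if (i : ℕ) = q - 1 then -1 else 0

/-- The Hessian matrix, in the coordinates `ε ↦ x + E ε` on the simplex, of
`x ↦ ∑ i, x i * (log (x i) - log (r i)) - c * log (xᵀ R x)`; it does not depend on `r`. -/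
def hessian {q : ℕ} (R : Matrix (Fin q) (Fin q) ℝ) (c : ℝ) (x : Fin q → ℝ) :
    Matrix (Fin (q - 1)) (Fin (q - 1)) ℝ :=
  (matE q)ᵀ *
    (Matrix.diagonal (fun i => (x i)⁻¹) +
      (2 * c / (x ⬝ᵥ R *ᵥ x)) •
        ((2 / (x ⬝ᵥ R *ᵥ x)) • Matrix.vecMulVec (R *ᵥ x) (x ᵥ* R) - R)) *
    matE q

/-- The supremum, possibly `⊤`, of the `c` such that the determinant of the Hessian matrix is
positive at all points of the interior of the simplex. -/
def beta {q : ℕ} (R : Matrix (Fin q) (Fin q) ℝ) : EReal :=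
  sSup (Real.toEReal '' {c : ℝ | ∀ x ∈ openSimplex q, 0 < (hessian R c x).det})

/-- `n^{2m} / (2^m m!) λ₁^m q^{n-m} ∏_{i ≥ 2} (1 - 2 (λ_i / λ₁) (m / n))^{-1/2}`, for the
sequence `lam` of eigenvalues, with `λ₁ = lam 0`. -/
def asymptoticValue {q : ℕ} [NeZero q] (lam : Fin q → ℝ) (n m : ℕ) : ℝ :=
  (n : ℝ) ^ (2 * m) / (2 ^ m * (m.factorial : ℝ)) * lam 0 ^ m * (q : ℝ) ^ ((n : ℤ) - (m : ℤ)) *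
    ∏ i ∈ Finset.univ.erase (0 : Fin q),
      (1 - 2 * (lam i / lam 0) * ((m : ℝ) / (n : ℝ))) ^ (-(1 / 2) : ℝ)

/-- `f(n, m) ∼ g(n, m)` as `n → ∞`, uniformly in the `m` such that `m / n ∈ [a, b]`. -/
def EquivalentOn (f g : ℕ → ℕ → ℝ) (a b : ℝ) : Prop :=
  ∀ ε > 0, ∃ N : ℕ, ∀ n m : ℕ, N ≤ n → (m : ℝ) / (n : ℝ) ∈ Set.Icc a b →
    |f n m / g n m - 1| < ε

end InhomGraph

end

/-!
Grouping the graphs by the numbers `k i` of vertices of each type, the weighted number of graphs is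
`(2 ^ m * m!)⁻¹` times the sum over `k` of the multinomial coefficient of `k` times `(kᵀ R k) ^ m`
(`numGraphs_eq_sum_multinomial`). Since the rows of `R` have the same sum, which is the largest
eigenvalue `λ₁` (`mulVec_one_eq_largest`), the quotient of the two sides of the asymptotic formula
is, up to the product over the eigenvalues, the expectation of `(q xᵀ R x / λ₁) ^ m`, where
`x = k / n` is the empirical distribution of `n` independent uniform types. This expectation is
`partitionSum`.

The deviations of `x` from the barycentre are Gaussian, of order `n ^ (-1/2)`, and at that scale
`(q xᵀ R x / λ₁) ^ m` is the exponential of a quadratic form. The limit is therefore a Gaussian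
integral on the vectors with sum zero, with the form `q (1 - (2 c / λ₁) R)` and `c = lim m / n`.
Its determinant is found by bordering with the all-ones vector (`det_conj_one_sub_smul`). To pass to
the limit, the expectation is written as the integral of a step function on `ℝ ^ (q - 1)`
(`integral_stepFunction`). Stirling's formula gives its pointwise limit (`tendsto_scaledWeight`),
and dominated convergence applies (`tendsto_partitionSum`) as soon as the relative entropy of `x`
dominates `c' log (q xᵀ R x / λ₁)` on the simplex for some `c'` larger than all the values of
`m / n` (`EntropyBound`, `exists_stepFunction_le`).

The entropy inequality is where the Hessian enters. Although the hypothesis only concerns the sign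
of its determinant, and for a single density `c'`, the Hessian is positive definite close to a
suitable vertex or midpoint of an edge of the simplex (`exists_posDef_hessian`), and positive
definiteness propagates along a connected family of invertible symmetric matrices. Hence the
function `∑ i, x i log (x i) - c' log (xᵀ R x)` is convex, and its critical point at the barycentre
is a minimum (`entropyBound_of_det_pos`). The second-order condition at this minimum shows that
`1 - 2 (λ_i / λ₁) c` is positive for `c < c'` and `i ≥ 2` (`EntropyBound.factor_pos`), which bounds
the critical density. If the other eigenvalues are not positive, then `R` is negative semidefinite on
the vectors with sum zero, and the entropy inequality holds for every density
(`entropyBound_of_nonpos`).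
-/

namespace InhomGraph

open MeasureTheory Filter Topology

/-! ### The tangent space of the simplex -/

/-- The matrix `E` of the tangent vectors of the simplex in `d + 1` variables, with its columns
indexed by `Fin d`. -/
def tangentBasis (d : ℕ) : Matrix (Fin (d + 1)) (Fin d) ℝ := matE (d + 1)

@[simp]
theorem tangentBasis_castSucc {d : ℕ} (i j : Fin d) :
    tangentBasis d i.castSucc j = if i = j then 1 else 0 := by
  have := i.isLt
  simp only [tangentBasis, matE, Matrix.of_apply, Fin.val_castSucc, Fin.ext_iff]
  split_ifs <;> first | rfl | omega

@[simp]
theorem tangentBasis_last {d : ℕ} (j : Fin d) : tangentBasis d (Fin.last d) j = -1 := by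
  have := j.isLt
  simp only [tangentBasis, matE, Matrix.of_apply, Fin.val_last]
  split_ifs <;> first | rfl | omega

@[simp]
theorem tangentBasis_mulVec_castSucc {d : ℕ} (u : Fin d → ℝ) (i : Fin d) :
    (tangentBasis d *ᵥ u) i.castSucc = u i := by
  simp [Matrix.mulVec, dotProduct]

@[simp]
theorem tangentBasis_mulVec_last {d : ℕ} (u : Fin d → ℝ) :
    (tangentBasis d *ᵥ u) (Fin.last d) = -∑ i, u i := by
  simp [Matrix.mulVec, dotProduct]

theorem sum_tangentBasis_mulVec {d : ℕ} (u : Fin d → ℝ) : ∑ i, (tangentBasis d *ᵥ u) i = 0 := by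
  simp [Fin.sum_univ_castSucc]

theorem exists_tangentBasis_mulVec_eq {d : ℕ} {z : Fin (d + 1) → ℝ} (hz : ∑ i, z i = 0) :
    ∃ u : Fin d → ℝ, tangentBasis d *ᵥ u = z := by
  refine ⟨fun i => z i.castSucc, ?_⟩
  ext i
  refine Fin.lastCases ?_ (fun i => ?_) i
  · rw [tangentBasis_mulVec_last]
    rw [Fin.sum_univ_castSucc] at hz
    linarith
  · rw [tangentBasis_mulVec_castSucc]

theorem tangentBasis_mulVec_injective (d : ℕ) :
    Function.Injective (fun u : Fin d → ℝ => tangentBasis d *ᵥ u) := by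
  intro u v h
  ext i
  have := congrFun h i.castSucc
  simpa using this

/-- A quadratic form pulled back along `E` is the form itself on the vectors with sum zero. -/
theorem dotProduct_conj_tangentBasis {d : ℕ} (A : Matrix (Fin (d + 1)) (Fin (d + 1)) ℝ)
    (u : Fin d → ℝ) :
    u ⬝ᵥ ((tangentBasis d)ᵀ * A * tangentBasis d) *ᵥ u
      = (tangentBasis d *ᵥ u) ⬝ᵥ A *ᵥ (tangentBasis d *ᵥ u) := by
  rw [← Matrix.mulVec_mulVec, ← Matrix.mulVec_mulVec, Matrix.dotProduct_mulVec,
    Matrix.vecMul_transpose]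

theorem isHermitian_conj_tangentBasis {d : ℕ} {A : Matrix (Fin (d + 1)) (Fin (d + 1)) ℝ}
    (hA : A.IsSymm) :
    ((tangentBasis d)ᵀ * A * tangentBasis d).IsHermitian := by
  rw [Matrix.isHermitian_iff_isSymm, Matrix.IsSymm]
  simp [Matrix.transpose_mul, hA.eq, Matrix.mul_assoc]

theorem posDef_conj_tangentBasis {d : ℕ} {A : Matrix (Fin (d + 1)) (Fin (d + 1)) ℝ} (hA : A.IsSymm)
    (h : ∀ z : Fin (d + 1) → ℝ, ∑ i, z i = 0 → z ≠ 0 → 0 < z ⬝ᵥ A *ᵥ z) :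
    ((tangentBasis d)ᵀ * A * tangentBasis d).PosDef := by
  refine Matrix.PosDef.of_dotProduct_mulVec_pos (isHermitian_conj_tangentBasis hA) fun u hu => ?_
  rw [star_trivial]
  have key := dotProduct_conj_tangentBasis A u
  refine lt_of_lt_of_eq (h _ (sum_tangentBasis_mulVec u) fun h0 => hu ?_) key.symm
  exact tangentBasis_mulVec_injective d (by simpa using h0)

/-! ### Positive definite matrices -/

/-- Along a connected family of invertible symmetric matrices, positive definiteness persists: it
is an open condition by compactness of the unit sphere, and a closed one because a positive
semidefinite invertible matrix is positive definite. -/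
theorem posDef_of_preconnectedSpace {X n : Type*} [TopologicalSpace X] [PreconnectedSpace X]
    [Fintype n] [DecidableEq n] {A : X → Matrix n n ℝ} (hA : Continuous A)
    (hherm : ∀ x, (A x).IsHermitian) (hdet : ∀ x, (A x).det ≠ 0) {x₀ : X}
    (h₀ : (A x₀).PosDef) (x : X) : (A x).PosDef := by
  have hq : Continuous fun p : X × (n → ℝ) => p.2 ⬝ᵥ A p.1 *ᵥ p.2 := by fun_prop
  have hopen : IsOpen {x | (A x).PosDef} := by
    rw [isOpen_iff_eventually]
    intro y hy
    have := (isCompact_sphere (0 : n → ℝ) 1).eventually_forall_of_forall_eventually (x₀ := y)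
      (P := fun x v => 0 < v ⬝ᵥ A x *ᵥ v) (fun v hv => by
        refine (hq.tendsto (y, v)).eventually_const_lt ?_
        have hv0 : v ≠ 0 := ne_zero_of_mem_unit_sphere ⟨v, hv⟩
        simpa using hy.dotProduct_mulVec_pos hv0)
    filter_upwards [this] with z hz
    refine Matrix.PosDef.of_dotProduct_mulVec_pos (hherm z) fun v hv => ?_
    have hn : 0 < ‖v‖ := norm_pos_iff.2 hv
    have h1 := hz (‖v‖⁻¹ • v) (by simp [norm_smul, hn.ne'])
    rw [Matrix.mulVec_smul, dotProduct_smul, smul_dotProduct, smul_smul, smul_eq_mul] at h1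
    simpa using (pos_of_mul_pos_right h1 (by positivity))
  have hclosed : IsClosed {x | (A x).PosDef} := by
    have : {x | (A x).PosDef} = {x | ∀ v : n → ℝ, 0 ≤ v ⬝ᵥ A x *ᵥ v} := by
      ext y
      refine ⟨fun hy v => by simpa using hy.posSemidef.dotProduct_mulVec_nonneg v, fun hy => ?_⟩
      have : (A y).PosSemidef :=
        Matrix.PosSemidef.of_dotProduct_mulVec_nonneg (hherm y) fun v => by simpa using hy v
      exact this.posDef_iff_det_ne_zero.2 (hdet y)
    rw [this, Set.ofPred_forall]
    refine isClosed_iInter fun v => isClosed_le continuous_const ?_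
    exact hq.comp (by fun_prop : Continuous fun x : X => (x, v))
  have huniv := IsClopen.eq_univ ⟨hclosed, hopen⟩ ⟨x₀, h₀⟩
  exact huniv.ge (Set.mem_univ x)

theorem posDef_of_isPreconnected {X n : Type*} [TopologicalSpace X] {S : Set X}
    (hS : IsPreconnected S) [Fintype n] [DecidableEq n] {A : X → Matrix n n ℝ}
    (hA : ContinuousOn A S) (hherm : ∀ x ∈ S, (A x).IsHermitian) (hdet : ∀ x ∈ S, (A x).det ≠ 0)
    {x₀ : X} (hx₀ : x₀ ∈ S) (h₀ : (A x₀).PosDef) {x : X} (hx : x ∈ S) : (A x).PosDef := by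
  have := Subtype.preconnectedSpace hS
  exact posDef_of_preconnectedSpace (A := fun y : S => A y) hA.domRestrict (fun y => hherm y y.2)
    (fun y => hdet y y.2) (x₀ := ⟨x₀, hx₀⟩) h₀ ⟨x, hx⟩

open scoped MatrixOrder in
/-- The Gaussian integral of a positive definite quadratic form. -/
theorem integral_exp_neg_half_quadratic {d : ℕ} {M : Matrix (Fin d) (Fin d) ℝ} (hM : M.PosDef) :
    ∫ u : Fin d → ℝ, Real.exp (-(1 / 2) * (u ⬝ᵥ M *ᵥ u))
      = Real.sqrt (2 * Real.pi) ^ d / Real.sqrt M.det := by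
  obtain ⟨B, hB⟩ := CStarAlgebra.nonneg_iff_eq_star_mul_self.1 hM.posSemidef.nonneg
  rw [Matrix.star_eq_conjTranspose, Matrix.conjTranspose_eq_transpose_of_trivial] at hB
  have hdet : M.det = B.det ^ 2 := by rw [hB, Matrix.det_mul, Matrix.det_transpose, sq]
  have hB0 : B.det ≠ 0 := by
    intro h
    have := hM.det_pos
    simp [hdet, h] at this
  have hmap := Real.map_matrix_volume_pi_eq_smul_volume_pi hB0
  have hstd : ∫ v : Fin d → ℝ, Real.exp (-(1 / 2) * (v ⬝ᵥ v)) = Real.sqrt (2 * Real.pi) ^ d := by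
    have h := integral_fintype_prod_volume_eq_pow (ι := Fin d)
      (fun x : ℝ => Real.exp (-(1 / 2) * x ^ 2))
    rw [integral_gaussian, Fintype.card_fin] at h
    rw [show 2 * Real.pi = Real.pi / (1 / 2) by ring, ← h]
    congr 1
    ext v
    rw [← Real.exp_sum, dotProduct, Finset.mul_sum]
    simp [sq]
  have hquad (u : Fin d → ℝ) : u ⬝ᵥ M *ᵥ u = (Matrix.toLin' B u) ⬝ᵥ (Matrix.toLin' B u) := by
    rw [hB, ← Matrix.mulVec_mulVec, Matrix.dotProduct_mulVec, Matrix.vecMul_transpose,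
      Matrix.toLin'_apply]
  simp_rw [hquad]
  have hmeas : Measurable (Matrix.toLin' B) := (LinearMap.continuous_on_pi _).measurable
  have hcont : Continuous fun v : Fin d → ℝ => Real.exp (-(1 / 2) * (v ⬝ᵥ v)) := by fun_prop
  rw [← integral_map (f := fun v : Fin d → ℝ => Real.exp (-(1 / 2) * (v ⬝ᵥ v))) hmeas.aemeasurable
    hcont.aestronglyMeasurable, hmap, integral_smul_measure, hstd, hdet, Real.sqrt_sq_eq_abs,
    ENNReal.toReal_ofReal (abs_nonneg _), abs_inv, smul_eq_mul]
  field_simp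

/-! ### A determinant in terms of the eigenvalues -/

theorem det_tangentBasis_transpose_mul_tangentBasis (d : ℕ) :
    ((tangentBasis d)ᵀ * tangentBasis d).det = (d : ℝ) + 1 := by
  set c : Matrix (Fin d) Unit ℝ := Matrix.replicateCol Unit fun _ => 1 with hc
  set r : Matrix Unit (Fin d) ℝ := Matrix.replicateRow Unit fun _ => 1 with hr
  have h : (tangentBasis d)ᵀ * tangentBasis d = 1 + c * r := by
    ext i j
    change ∑ k, tangentBasis d k i * tangentBasis d k j = _
    rw [Fin.sum_univ_castSucc]
    simp [hc, hr, Matrix.mul_apply, Matrix.one_apply, eq_comm]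
  rw [h]
  refine (Matrix.det_one_add_replicateCol_mul_replicateRow (ι := Unit) _ _).trans ?_
  simp [dotProduct, add_comm]

/-- Bordering by the all-ones vector, which is orthogonal to the columns of `E`, splits off its
eigenvalue. -/
theorem det_conj_tangentBasis_mul_eigenvalue {d : ℕ}
    {A : Matrix (Fin (d + 1)) (Fin (d + 1)) ℝ}
    (hA : A.IsSymm) {α : ℝ} (hone : A *ᵥ (fun _ => 1) = fun _ => α) :
    ((tangentBasis d)ᵀ * A * tangentBasis d).det * α = ((d : ℝ) + 1) * A.det := by
  set E : Matrix (Fin (d + 1)) (Fin d) ℝ := tangentBasis d with hE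
  -- The identity below is used for `A` and for `1`, the latter giving the square of the determinant
  -- of the change of basis.
  set e : Fin d ⊕ Fin 1 ≃ Fin (d + 1) := finSumFinEquiv
  set J : Matrix (Fin (d + 1)) (Fin 1) ℝ := Matrix.replicateCol (Fin 1) (fun _ => (1 : ℝ)) with hJ
  have hEJ : Eᵀ * J = 0 := by
    ext i j
    simp [hE, hJ, Matrix.mul_apply, Fin.sum_univ_castSucc]
  have bordered (B : Matrix (Fin (d + 1)) (Fin (d + 1)) ℝ) (hB : B.IsSymm) (γ : ℝ)
      (hγ : B *ᵥ (fun _ => 1) = fun _ => γ) :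
      (Eᵀ * B * E).det * (((d : ℝ) + 1) * γ) =
        ((Matrix.fromCols E J).submatrix id e.symm).det ^ 2 * B.det := by
    have hBJ : B * J = γ • J := by
      ext i j
      have := congrFun hγ i
      simpa [hJ, Matrix.mul_apply, Matrix.mulVec, dotProduct] using this
    have hJB : Jᵀ * B = γ • Jᵀ := by
      rw [← Matrix.transpose_smul, ← hBJ, Matrix.transpose_mul, hB.eq]
    have hJE : Jᵀ * E = 0 := by
      rw [← Matrix.transpose_transpose E, ← Matrix.transpose_mul, hEJ, Matrix.transpose_zero]
    have hblock : (Matrix.fromCols E J)ᵀ * B * Matrix.fromCols E J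
        = Matrix.fromBlocks (Eᵀ * B * E) 0 0 (γ • (Jᵀ * J)) := by
      rw [Matrix.transpose_fromCols, Matrix.fromRows_mul, Matrix.fromRows_mul_fromCols, hJB,
        Matrix.mul_assoc _ B J, hBJ, Matrix.mul_smul, Matrix.smul_mul, Matrix.smul_mul, hEJ, hJE]
      simp
    have hcard : (γ • (Jᵀ * J)).det = ((d : ℝ) + 1) * γ := by
      simp [hJ, Matrix.mul_apply, mul_comm]
    rw [← hcard, ← Matrix.det_fromBlocks_zero₂₁, ← hblock, ← Matrix.det_submatrix_equiv_self e.symm,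
      ← Matrix.submatrix_mul_equiv _ _ _ (Equiv.refl _) _,
      ← Matrix.submatrix_mul_equiv _ _ _ (Equiv.refl _) _, Matrix.det_mul, Matrix.det_mul]
    rw [← Matrix.det_transpose, sq]
    simp only [Matrix.transpose_submatrix, Matrix.transpose_transpose, Equiv.coe_refl,
      Matrix.submatrix_id_id]
    ring
  have h1 := bordered 1 (by simp) 1 (by simp)
  have h2 := bordered A hA α hone
  have h3 := det_tangentBasis_transpose_mul_tangentBasis d
  rw [← hE] at h3
  rw [Matrix.mul_one, Matrix.det_one, mul_one, mul_one, h3] at h1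
  rw [← h1] at h2
  have h0 : ((d : ℝ) + 1) ≠ 0 := by positivity
  exact mul_left_cancel₀ h0 (by linarith)

theorem det_one_sub_smul_of_roots {n : Type*} [Fintype n] [DecidableEq n] {R : Matrix n n ℝ}
    {lam : n → ℝ} (hroots : R.charpoly.roots = Finset.univ.val.map lam) (s : ℝ) :
    (1 - s • R).det = ∏ i, (1 - s * lam i) := by
  have hprod : (R.charpoly.roots.map fun a => Polynomial.X - Polynomial.C a).prod = R.charpoly := by
    refine Polynomial.prod_multiset_X_sub_C_of_monic_of_roots_card_eq R.charpoly_monic ?_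
    rw [hroots, Matrix.charpoly_natDegree_eq_dim]
    simp
  rcases eq_or_ne s 0 with rfl | hs
  · simp
  have h : R.charpoly.eval s⁻¹ = ∏ i, (s⁻¹ - lam i) := by
    rw [← hprod, hroots, Multiset.map_map, ← Finset.prod_eq_multiset_prod, Polynomial.eval_prod]
    simp
  have h1 : (1 - s • R) = s • (Matrix.scalar n s⁻¹ - R) := by
    ext i j
    by_cases hij : i = j
    · simp [hij, mul_sub, hs]
    · simp [hij]
  rw [h1, Matrix.det_smul, ← Matrix.eval_charpoly, h, Fintype.card, ← Finset.prod_const,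
    ← Finset.prod_mul_distrib]
  exact Finset.prod_congr rfl fun i _ => by field_simp

/-- On the vectors with sum zero, `1 - s R` has the eigenvalues `1 - s λ_i` with `i ≥ 2`. -/
theorem det_conj_one_sub_smul {d : ℕ} {R : Matrix (Fin (d + 1)) (Fin (d + 1)) ℝ}
    (hsymm : R.IsSymm) {lam : Fin (d + 1) → ℝ}
    (hroots : R.charpoly.roots = Finset.univ.val.map lam)
    (hone : R *ᵥ (fun _ => 1) = fun _ => lam 0) (s : ℝ) :
    ((tangentBasis d)ᵀ * (1 - s • R) * tangentBasis d).det
      = ((d : ℝ) + 1) * ∏ i ∈ Finset.univ.erase 0, (1 - s * lam i) := by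
  set f : ℝ → ℝ := fun s => ((tangentBasis d)ᵀ * (1 - s • R) * tangentBasis d).det
  set g : ℝ → ℝ := fun s => ((d : ℝ) + 1) * ∏ i ∈ Finset.univ.erase 0, (1 - s * lam i)
  have hf : Continuous f := by fun_prop
  have hg : Continuous g := by fun_prop
  -- The factor `1 - s λ₁` can be cancelled except at one point, which continuity recovers.
  have key (s : ℝ) (hs : s ∈ ({(lam 0)⁻¹}ᶜ : Set ℝ)) : f s = g s := by
    have h1 : (1 - s • R) *ᵥ (fun _ => 1) = fun _ => 1 - s * lam 0 := by
      rw [Matrix.sub_mulVec, Matrix.smul_mulVec, hone]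
      ext i
      simp
    have h2 := det_conj_tangentBasis_mul_eigenvalue
      (show (1 - s • R).IsSymm by simp [Matrix.IsSymm, hsymm.eq]) h1
    rw [det_one_sub_smul_of_roots hroots, ← Finset.mul_prod_erase _ _ (Finset.mem_univ 0)] at h2
    have h3 : 1 - s * lam 0 ≠ 0 := fun h => hs (eq_inv_of_mul_eq_one_left (by linarith))
    refine mul_right_cancel₀ h3 (h2.trans ?_)
    simp only [g]
    ring
  exact congrFun (hf.ext_on (dense_compl_singleton _) hg key) s

/-! ### The Hessian form -/

theorem vecMul_eq_mulVec_of_isSymm {n : Type*} [Fintype n] {R : Matrix n n ℝ}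
    (hR : R.IsSymm) (x : n → ℝ) :
    x ᵥ* R = R *ᵥ x := by
  conv_lhs => rw [← hR.eq]
  exact Matrix.vecMul_transpose R x

theorem dotProduct_mulVec_comm {n : Type*} [Fintype n] {R : Matrix n n ℝ} (hR : R.IsSymm)
    (x y : n → ℝ) : x ⬝ᵥ R *ᵥ y = y ⬝ᵥ R *ᵥ x := by
  rw [Matrix.dotProduct_mulVec, vecMul_eq_mulVec_of_isSymm hR, dotProduct_comm]

/-- The second derivative of `x ↦ ∑ i, x i * log (x i) - c * log (xᵀ R x)` in the direction `z`. -/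
noncomputable def hessianForm {n : Type*} [Fintype n] (R : Matrix n n ℝ) (c : ℝ)
    (x z : n → ℝ) : ℝ :=
  ∑ i, z i ^ 2 / x i +
    2 * c / (x ⬝ᵥ R *ᵥ x) * (2 / (x ⬝ᵥ R *ᵥ x) * (z ⬝ᵥ R *ᵥ x) ^ 2 - z ⬝ᵥ R *ᵥ z)

/-- The matrix of `hessianForm` in the ambient coordinates. -/
noncomputable def ambientHessian {n : Type*} [Fintype n] [DecidableEq n] (R : Matrix n n ℝ) (c : ℝ)
    (x : n → ℝ) : Matrix n n ℝ :=
  Matrix.diagonal (fun i => (x i)⁻¹) + (2 * c / (x ⬝ᵥ R *ᵥ x)) •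
    ((2 / (x ⬝ᵥ R *ᵥ x)) • Matrix.vecMulVec (R *ᵥ x) (x ᵥ* R) - R)

theorem ambientHessian_isSymm {n : Type*} [Fintype n] [DecidableEq n] {R : Matrix n n ℝ}
    (hR : R.IsSymm) (c : ℝ) (x : n → ℝ) : (ambientHessian R c x).IsSymm := by
  simp [ambientHessian, Matrix.IsSymm, vecMul_eq_mulVec_of_isSymm hR, hR.eq,
    Matrix.transpose_vecMulVec]

theorem dotProduct_ambientHessian {n : Type*} [Fintype n] [DecidableEq n] {R : Matrix n n ℝ}
    (hR : R.IsSymm) (c : ℝ) (x z : n → ℝ) :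
    z ⬝ᵥ ambientHessian R c x *ᵥ z = hessianForm R c x z := by
  have h1 : z ⬝ᵥ Matrix.diagonal (fun i => (x i)⁻¹) *ᵥ z = ∑ i, z i ^ 2 / x i := by
    simp only [dotProduct, Matrix.mulVec_diagonal]
    exact Finset.sum_congr rfl fun i _ => by ring
  have h2 : z ⬝ᵥ Matrix.vecMulVec (R *ᵥ x) (x ᵥ* R) *ᵥ z = (z ⬝ᵥ R *ᵥ x) ^ 2 := by
    rw [vecMul_eq_mulVec_of_isSymm hR, Matrix.vecMulVec_mulVec, dotProduct_comm (R *ᵥ x) z]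
    simp [sq]
  simp only [ambientHessian, hessianForm, Matrix.add_mulVec, Matrix.smul_mulVec, Matrix.sub_mulVec,
    dotProduct_add, dotProduct_smul, dotProduct_sub, h1, h2, smul_eq_mul]

theorem hessianForm_nonneg_of_posDef {d : ℕ} {R : Matrix (Fin (d + 1)) (Fin (d + 1)) ℝ}
    (hR : R.IsSymm) {c : ℝ} {x : Fin (d + 1) → ℝ} (h : (hessian R c x).PosDef)
    {z : Fin (d + 1) → ℝ} (hz : ∑ i, z i = 0) : 0 ≤ hessianForm R c x z := by
  obtain ⟨u, rfl⟩ := exists_tangentBasis_mulVec_eq hz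
  have h1 := h.posSemidef.dotProduct_mulVec_nonneg u
  rw [star_trivial] at h1
  have h2 := dotProduct_conj_tangentBasis (ambientHessian R c x) u
  rw [dotProduct_ambientHessian hR] at h2
  exact h1.trans_eq h2

theorem posDef_hessian_of_form_pos {d : ℕ} {R : Matrix (Fin (d + 1)) (Fin (d + 1)) ℝ}
    (hR : R.IsSymm) {c : ℝ} {x : Fin (d + 1) → ℝ}
    (h : ∀ z : Fin (d + 1) → ℝ, ∑ i, z i = 0 → z ≠ 0 → 0 < hessianForm R c x z) :
    (hessian R c x).PosDef :=
  posDef_conj_tangentBasis (ambientHessian_isSymm hR c x) fun z hz hz0 => by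
    exact (h z hz hz0).trans_eq (dotProduct_ambientHessian hR c x z).symm

/-! ### A point where the Hessian is positive definite -/

theorem dotProduct_mulVec_le_sum_sq {n : Type*} [Fintype n] {R : Matrix n n ℝ}
    (hnn : ∀ i j, 0 ≤ R i j) (z : n → ℝ) :
    z ⬝ᵥ R *ᵥ z ≤ (∑ i, ∑ j, R i j) * ∑ k, z k ^ 2 := by
  have h (i j : n) : z i * (R i j * z j) ≤ R i j * ∑ k, z k ^ 2 := by
    have h1 := Finset.single_le_sum (fun k _ => sq_nonneg (z k)) (Finset.mem_univ i)
    have h2 := Finset.single_le_sum (fun k _ => sq_nonneg (z k)) (Finset.mem_univ j)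
    nlinarith [hnn i j, sq_nonneg (z i - z j)]
  simp only [dotProduct, Matrix.mulVec, Finset.sum_mul]
  refine Finset.sum_le_sum fun i _ => ?_
  rw [Finset.mul_sum]
  exact Finset.sum_le_sum fun j _ => h i j

theorem mul_apply_mul_le_dotProduct {n : Type*} [Fintype n] {R : Matrix n n ℝ}
    (hnn : ∀ i j, 0 ≤ R i j) {x : n → ℝ} (hx : ∀ i, 0 ≤ x i) (i j : n) :
    x i * (R i j * x j) ≤ x ⬝ᵥ R *ᵥ x := by
  have h (a : n) (b : n) : 0 ≤ R a b * x b := mul_nonneg (hnn a b) (hx b)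
  calc x i * (R i j * x j) ≤ x i * (R *ᵥ x) i :=
        mul_le_mul_of_nonneg_left
          (Finset.single_le_sum (f := fun b => R i b * x b) (fun b _ => h i b) (Finset.mem_univ j))
          (hx i)
    _ ≤ _ := Finset.single_le_sum (f := fun a => x a * (R *ᵥ x) a)
        (fun a _ => mul_nonneg (hx a) (Finset.sum_nonneg fun b _ => h a b)) (Finset.mem_univ i)

/-- If `zᵀ R z` is controlled, on the vectors with sum zero, by the coordinates outside `T`, and
the type graph has an edge inside `T`, then the Hessian is positive definite at the points close
enough to the barycentre of the face `T`: the entries `1 / x k` with `k ∉ T` are large there. -/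
theorem exists_posDef_hessian_of_face {d : ℕ} {R : Matrix (Fin (d + 1)) (Fin (d + 1)) ℝ}
    (hR : R.IsSymm) (hnn : ∀ i j, 0 ≤ R i j) {c : ℝ} (hc : 0 < c) {T : Finset (Fin (d + 1))}
    {i j : Fin (d + 1)} (hi : i ∈ T) (hj : j ∈ T) (hij : 0 < R i j) {C : ℝ}
    (hC : ∀ z : Fin (d + 1) → ℝ, ∑ k, z k = 0 → z ⬝ᵥ R *ᵥ z ≤ C * ∑ k ∈ Tᶜ, z k ^ 2) :
    ∃ x ∈ openSimplex (d + 1), (hessian R c x).PosDef := by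
  have hT : (0 : ℝ) < T.card := by exact_mod_cast Finset.card_pos.2 ⟨i, hi⟩
  have hTd : (T.card : ℝ) + Tᶜ.card = d + 1 := by
    have := Finset.card_add_card_compl T
    rw [Fintype.card_fin] at this
    exact_mod_cast this
  have hTc : (0 : ℝ) ≤ Tᶜ.card := by positivity
  -- A lower bound for `xᵀ R x` at the chosen point, whose coordinates in `T` are at least
  -- `1 / (2 (d + 1))`.
  set q₀ : ℝ := R i j / (4 * (d + 1) ^ 2) with hq₀
  have hq₀pos : 0 < q₀ := by positivity
  -- The coordinates outside `T` are `δ < 1 / K`, so that `K * z k ^ 2 < z k ^ 2 / δ`.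
  set K : ℝ := 2 * c / q₀ * |C| with hK
  have hK0 : 0 ≤ K := by positivity
  set δ : ℝ := 1 / (2 * (d + 1) + K) with hδ
  have hδ0 : 0 < δ := by positivity
  have hδ1 : δ * (2 * (d + 1) + K) = 1 := by rw [hδ]; field_simp
  have hd : (0 : ℝ) ≤ d := by positivity
  have hδs : Tᶜ.card * δ ≤ 1 / 2 := by nlinarith [mul_nonneg hδ0.le hK0]
  set a : ℝ := (1 - Tᶜ.card * δ) / T.card with ha
  have hTa : T.card * a = 1 - Tᶜ.card * δ := by rw [ha]; field_simp
  have ha' : 1 / (2 * (d + 1)) ≤ a := by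
    rw [ha, div_le_div_iff₀ (by positivity) hT]
    nlinarith
  have ha0 : 0 < a := lt_of_lt_of_le (by positivity) ha'
  set x : Fin (d + 1) → ℝ := fun k => if k ∈ T then a else δ with hx
  have hx0 (k) : 0 < x k := by simp only [hx]; split_ifs <;> assumption
  refine ⟨x, ⟨hx0, ?_⟩, ?_⟩
  · rw [← Finset.sum_add_sum_compl T,
      Finset.sum_congr rfl (g := fun _ => a) (by simp +contextual [hx]),
      Finset.sum_congr (s₁ := Tᶜ) rfl (g := fun _ => δ) (by simp +contextual [hx])]
    simp [hTa]
  refine posDef_hessian_of_form_pos hR fun z hz hz0 => ?_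
  set Q := x ⬝ᵥ R *ᵥ x with hQ
  have hQ0 : q₀ ≤ Q := by
    refine le_trans ?_ (mul_apply_mul_le_dotProduct hnn (fun k => (hx0 k).le) i j)
    have e1 : x i = a := by simp [hx, hi]
    have e2 : x j = a := by simp [hx, hj]
    rw [e1, e2, hq₀]
    calc R i j / (4 * (d + 1) ^ 2) = 1 / (2 * (d + 1)) * (R i j * (1 / (2 * (d + 1)))) := by
          field_simp; ring
      _ ≤ _ := by gcongr
  have hQpos : 0 < Q := hq₀pos.trans_le hQ0
  have hsum : 0 < ∑ k, z k ^ 2 / x k := by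
    obtain ⟨k, hk⟩ := Function.ne_iff.1 hz0
    refine Finset.sum_pos' (fun k _ => by have := hx0 k; positivity) ⟨k, Finset.mem_univ k, ?_⟩
    have := hx0 k
    have : z k ≠ 0 := hk
    positivity
  have hmain : 2 * c / Q * (z ⬝ᵥ R *ᵥ z) < ∑ k, z k ^ 2 / x k := by
    rcases le_or_gt (z ⬝ᵥ R *ᵥ z) 0 with h0 | h0
    · exact lt_of_le_of_lt (mul_nonpos_of_nonneg_of_nonpos (by positivity) h0) hsum
    set W := ∑ k ∈ Tᶜ, z k ^ 2 with hW
    have hW0 : 0 ≤ W := Finset.sum_nonneg fun k _ => sq_nonneg _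
    have h1 : z ⬝ᵥ R *ᵥ z ≤ |C| * W :=
      (hC z hz).trans (mul_le_mul_of_nonneg_right (le_abs_self C) hW0)
    have hWpos : 0 < W := by
      rcases hW0.eq_or_lt with h | h
      · rw [← h, mul_zero] at h1
        exact absurd h0 h1.not_gt
      · exact h
    calc 2 * c / Q * (z ⬝ᵥ R *ᵥ z) ≤ 2 * c / q₀ * (|C| * W) := by gcongr
      _ = K * W := by rw [hK]; ring
      _ < W / δ := by
        rw [lt_div_iff₀ hδ0]
        nlinarith [mul_pos hWpos hδ0]
      _ = ∑ k ∈ Tᶜ, z k ^ 2 / x k := by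
        rw [hW, Finset.sum_div]
        exact Finset.sum_congr rfl fun k hk => by simp [hx, Finset.mem_compl.1 hk]
      _ ≤ _ := Finset.sum_le_univ_sum_of_nonneg fun k => by have := hx0 k; positivity
  have hsq : 0 ≤ 2 * c / Q * (2 / Q * (z ⬝ᵥ R *ᵥ x) ^ 2) := by positivity
  simp only [hessianForm, ← hQ, mul_sub]
  linarith

/-- If `R i i > 0` the face is the vertex `i`, on which no nonzero vector has sum zero. If the
diagonal is zero and `R i j > 0` the face is the edge `{i, j}`, and the form is negative on its
direction `e_i - e_j`. -/
theorem exists_posDef_hessian {d : ℕ} {R : Matrix (Fin (d + 1)) (Fin (d + 1)) ℝ}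
    (hR : R.IsSymm) (hnn : ∀ i j, 0 ≤ R i j) (hpos : ∃ i j, 0 < R i j) {c : ℝ} (hc : 0 < c) :
    ∃ x ∈ openSimplex (d + 1), (hessian R c x).PosDef := by
  set B := ∑ i, ∑ j, R i j with hB
  have hB0 : 0 ≤ B := Finset.sum_nonneg fun i _ => Finset.sum_nonneg fun j _ => hnn i j
  have hcs (T : Finset (Fin (d + 1))) (z : Fin (d + 1) → ℝ) :
      (∑ k ∈ Tᶜ, z k) ^ 2 ≤ (d + 1) * ∑ k ∈ Tᶜ, z k ^ 2 := by
    refine sq_sum_le_card_mul_sum_sq.trans ?_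
    have : (Tᶜ.card : ℝ) ≤ d + 1 := by
      have := Finset.card_le_univ Tᶜ
      rw [Fintype.card_fin] at this
      exact_mod_cast this
    gcongr
  by_cases hdiag : ∃ i, 0 < R i i
  · obtain ⟨i, hi⟩ := hdiag
    refine exists_posDef_hessian_of_face (T := {i}) (C := B * (d + 2)) hR hnn hc
      (Finset.mem_singleton_self i) (Finset.mem_singleton_self i) hi fun z hz => ?_
    refine (dotProduct_mulVec_le_sum_sq hnn z).trans ?_
    rw [mul_assoc]
    refine mul_le_mul_of_nonneg_left ?_ hB0
    have h1 := hcs {i} z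
    rw [← Finset.sum_add_sum_compl {i}, Finset.sum_singleton] at hz ⊢
    rw [show ∑ k ∈ {i}ᶜ, z k = - z i by linarith] at h1
    nlinarith
  · push Not at hdiag
    obtain ⟨i, j, hij⟩ := hpos
    have hne : i ≠ j := by
      rintro rfl
      exact absurd hij (hdiag i).not_gt
    have hii : R i i = 0 := le_antisymm (hdiag i) (hnn i i)
    have hjj : R j j = 0 := le_antisymm (hdiag j) (hnn j j)
    set L := ∑ k, (R i k - R j k) ^ 2 with hL
    have hL0 : 0 ≤ L := Finset.sum_nonneg fun k _ => sq_nonneg _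
    refine exists_posDef_hessian_of_face (T := {i, j}) (C := (L / (2 * R i j) + B) * (d + 2))
      hR hnn hc (by simp) (by simp) hij fun z hz => ?_
    set W := ∑ k ∈ ({i, j} : Finset _)ᶜ, z k ^ 2 with hW
    set u := (z i - z j) / 2 with hu
    set e : Fin (d + 1) → ℝ := Pi.single i 1 - Pi.single j 1 with he
    set w : Fin (d + 1) → ℝ := z - u • e with hw
    have hzw : z = w + u • e := by rw [hw]; simp
    have hee : e ⬝ᵥ R *ᵥ e = -2 * R i j := by
      simp [he, Matrix.mulVec_sub, hii, hjj, hR.apply i j]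
      ring
    have hew : (e ⬝ᵥ R *ᵥ w) ^ 2 ≤ L * ∑ k, w k ^ 2 := by
      have : e ⬝ᵥ R *ᵥ w = ∑ k, (R i k - R j k) * w k := by
        rw [he, sub_dotProduct, single_one_dotProduct, single_one_dotProduct]
        simp [Matrix.mulVec, dotProduct, sub_mul]
      rw [this]
      exact Finset.sum_mul_sq_le_sq_mul_sq _ _ _
    have hww : ∑ k, w k ^ 2 ≤ (d + 2) * W := by
      have h1 := hcs {i, j} z
      rw [← Finset.sum_add_sum_compl {i, j}, Finset.sum_pair hne] at hz ⊢
      have h2 : ∑ k ∈ ({i, j} : Finset _)ᶜ, w k ^ 2 = W := by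
        refine Finset.sum_congr rfl fun k hk => ?_
        simp only [Finset.mem_compl, Finset.mem_insert, Finset.mem_singleton, not_or] at hk
        simp [hw, he, hk.1, hk.2]
      have h3 : w i = (z i + z j) / 2 := by simp [hw, he, hne, hu]; ring
      have h4 : w j = (z i + z j) / 2 := by simp [hw, he, hne.symm, hu]; ring
      rw [h2, h3, h4]
      rw [show ∑ k ∈ ({i, j} : Finset _)ᶜ, z k = - (z i + z j) by linarith] at h1
      nlinarith
    have hexp : z ⬝ᵥ R *ᵥ z = w ⬝ᵥ R *ᵥ w + 2 * u * (e ⬝ᵥ R *ᵥ w) + u ^ 2 * (-2 * R i j) := by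
      rw [← hee, hzw]
      simp only [Matrix.mulVec_add, Matrix.mulVec_smul, dotProduct_add, add_dotProduct,
        dotProduct_smul, smul_dotProduct, smul_eq_mul]
      rw [dotProduct_mulVec_comm hR w e]
      ring
    have hbw := dotProduct_mulVec_le_sum_sq hnn w
    -- Completing the square in the component `u` along the edge.
    have hcomplete : 2 * u * (e ⬝ᵥ R *ᵥ w) + u ^ 2 * (-2 * R i j)
        ≤ (e ⬝ᵥ R *ᵥ w) ^ 2 / (2 * R i j) := by
      rw [le_div_iff₀ (by positivity)]
      nlinarith [sq_nonneg (e ⬝ᵥ R *ᵥ w - 2 * R i j * u)]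
    calc z ⬝ᵥ R *ᵥ z ≤ B * ∑ k, w k ^ 2 + L * (∑ k, w k ^ 2) / (2 * R i j) := by
          have : (e ⬝ᵥ R *ᵥ w) ^ 2 / (2 * R i j) ≤ L * (∑ k, w k ^ 2) / (2 * R i j) := by gcongr
          linarith
      _ = (L / (2 * R i j) + B) * ∑ k, w k ^ 2 := by ring
      _ ≤ (L / (2 * R i j) + B) * ((d + 2) * W) := by gcongr
      _ = _ := by ring

/-! ### The entropy inequality -/

/-- The relative entropy `∑ i, x i * log (q * x i)` of `x` with respect to the uniform distribution
on `q = d + 1` points. -/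
noncomputable def relEntropy {d : ℕ} (x : Fin (d + 1) → ℝ) : ℝ :=
  ∑ i, x i * Real.log ((d + 1) * x i)

/-- `q xᵀ R x / μ`: the quadratic form of `R`, normalised to be `1` at the barycentre of the simplex
when all rows of `R` have sum `μ`. -/
noncomputable def normForm {d : ℕ} (R : Matrix (Fin (d + 1)) (Fin (d + 1)) ℝ) (μ : ℝ)
    (x : Fin (d + 1) → ℝ) : ℝ :=
  (d + 1) / μ * (x ⬝ᵥ R *ᵥ x)

/-- The function `x ↦ ∑ i, x i * log (x i) - c * log (xᵀ R x)` is minimal at the barycentre of the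
simplex. The inequality is exponentiated so that it makes sense where `xᵀ R x = 0`. -/
def EntropyBound {d : ℕ} (R : Matrix (Fin (d + 1)) (Fin (d + 1)) ℝ) (μ c : ℝ) : Prop :=
  ∀ x : Fin (d + 1) → ℝ, (∀ i, 0 ≤ x i) → ∑ i, x i = 1 →
    normForm R μ x ^ c ≤ Real.exp (relEntropy x)

theorem mul_log_nat_mul {d : ℕ} (t : ℝ) :
    t * Real.log ((d + 1) * t) = t * Real.log (d + 1) + t * Real.log t := by
  rcases eq_or_ne t 0 with rfl | ht
  · simp
  · rw [Real.log_mul (by positivity) ht]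
    ring

theorem continuous_relEntropy {d : ℕ} : Continuous (relEntropy (d := d)) := by
  unfold relEntropy
  simp only [mul_log_nat_mul]
  have := Real.continuous_mul_log
  fun_prop

theorem continuous_normForm {d : ℕ} (R : Matrix (Fin (d + 1)) (Fin (d + 1)) ℝ) (μ : ℝ) :
    Continuous (normForm R μ) := by
  unfold normForm
  fun_prop

/-- A quadratic lower bound for the relative entropy, from `log t ≤ t - 1` at
`t = (q x)^(-1/2)`. -/
theorem sum_sq_sub_le_relEntropy {d : ℕ} {x : Fin (d + 1) → ℝ} (hx : ∀ i, 0 ≤ x i)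
    (hx1 : ∑ i, x i = 1) : 1 / 4 * ∑ i, (x i - 1 / (d + 1)) ^ 2 ≤ relEntropy x := by
  have hd : (0 : ℝ) < d + 1 := by positivity
  set a : ℝ := 1 / (d + 1) with ha
  have ha0 : 0 < a := by positivity
  have ha1 : a ≤ 1 := by
    rw [ha, div_le_one hd]
    have : (0 : ℝ) ≤ d := by positivity
    linarith
  have key (t : ℝ) (ht : 0 ≤ t) (ht1 : t ≤ 1) :
      1 / 4 * (t - a) ^ 2 + (t - a) ≤ t * Real.log ((d + 1) * t) := by
    rcases ht.eq_or_lt with rfl | ht0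
    · simp only [zero_mul]
      nlinarith
    have hs : (√t) ^ 2 = t := Real.sq_sqrt ht
    have hr : (√a) ^ 2 = a := Real.sq_sqrt ha0.le
    have hs0 : 0 < √t := Real.sqrt_pos.2 ht0
    have hr0 : 0 < √a := Real.sqrt_pos.2 ha0
    have hs1 : √t ≤ 1 := Real.sqrt_le_one.2 ht1
    have hr1 : √a ≤ 1 := Real.sqrt_le_one.2 ha1
    have hlog : Real.log ((d + 1) * t) = -2 * Real.log (√a / √t) := by
      rw [Real.log_div hr0.ne' hs0.ne', Real.log_sqrt ha0.le, Real.log_sqrt ht, ha, one_div,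
        Real.log_inv, Real.log_mul hd.ne' ht0.ne']
      ring
    have h1 := Real.log_le_sub_one_of_pos (div_pos hr0 hs0)
    have h2 : t * (√a / √t) = √t * √a := by
      nth_rw 1 [← hs]
      field_simp
    have h3 : 2 * t - 2 * (√t * √a) ≤ t * Real.log ((d + 1) * t) := by
      rw [hlog, ← h2]
      nlinarith
    have h4 : (t - a) ^ 2 ≤ 4 * (√t - √a) ^ 2 := by
      have : t - a = (√t - √a) * (√t + √a) := by ring_nf; rw [hs, hr]
      rw [this, mul_pow, mul_comm]
      refine mul_le_mul_of_nonneg_right ?_ (sq_nonneg _)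
      nlinarith
    nlinarith
  have hle (i) : x i ≤ 1 := hx1 ▸ Finset.single_le_sum (fun j _ => hx j) (Finset.mem_univ i)
  have := Finset.sum_le_sum fun i (_ : i ∈ Finset.univ) => key (x i) (hx i) (hle i)
  rw [Finset.sum_add_distrib, Finset.sum_sub_distrib, hx1, ← Finset.mul_sum] at this
  have hcard : ∑ _i : Fin (d + 1), a = 1 := by simp [ha]; field_simp
  rw [hcard] at this
  unfold relEntropy
  linarith

theorem relEntropy_nonneg {d : ℕ} {x : Fin (d + 1) → ℝ} (hx : ∀ i, 0 ≤ x i)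
    (hx1 : ∑ i, x i = 1) : 0 ≤ relEntropy x :=
  le_trans (by positivity) (sum_sq_sub_le_relEntropy hx hx1)

theorem convex_openSimplex (q : ℕ) : Convex ℝ (openSimplex q) := by
  intro x hx y hy a b ha hb hab
  refine ⟨fun i => ?_, ?_⟩
  · have h1 := hx.1 i
    have h2 := hy.1 i
    rcases ha.eq_or_lt with rfl | ha
    · have : b = 1 := by linarith
      simp [this, h2]
    · have : 0 < a * x i + b * y i := by positivity
      simpa using this
  · simp [Finset.sum_add_distrib, ← Finset.mul_sum, hx.2, hy.2, hab]

theorem barycentre_mem_openSimplex (d : ℕ) :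
    (fun _ => 1 / ((d : ℝ) + 1)) ∈ openSimplex (d + 1) := by
  refine ⟨fun _ => by positivity, ?_⟩
  simp
  field_simp

theorem dotProduct_mulVec_pos {d : ℕ} {R : Matrix (Fin (d + 1)) (Fin (d + 1)) ℝ}
    (hnn : ∀ i j, 0 ≤ R i j) (hpos : ∃ i j, 0 < R i j) {x : Fin (d + 1) → ℝ} (hx : ∀ i, 0 < x i) :
    0 < x ⬝ᵥ R *ᵥ x := by
  obtain ⟨i, j, hij⟩ := hpos
  refine lt_of_lt_of_le ?_ (mul_apply_mul_le_dotProduct hnn (fun k => (hx k).le) i j)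
  have := hx i
  have := hx j
  positivity

/-- If the determinant of the Hessian has no zero in the open simplex, the Hessian is positive
definite in the whole open simplex, because it is so at some point. -/
theorem posDef_hessian_of_det_pos {d : ℕ} {R : Matrix (Fin (d + 1)) (Fin (d + 1)) ℝ}
    (hR : R.IsSymm) (hnn : ∀ i j, 0 ≤ R i j) (hpos : ∃ i j, 0 < R i j) {c : ℝ} (hc : 0 < c)
    (hdet : ∀ x ∈ openSimplex (d + 1), 0 < (hessian R c x).det) {x : Fin (d + 1) → ℝ}
    (hx : x ∈ openSimplex (d + 1)) : (hessian R c x).PosDef := by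
  obtain ⟨x₀, hx₀, h₀⟩ := exists_posDef_hessian hR hnn hpos hc
  have := Subtype.preconnectedSpace (convex_openSimplex (d + 1)).isPreconnected
  refine posDef_of_preconnectedSpace (A := fun y : openSimplex (d + 1) => hessian R c y) ?_
    (fun y => isHermitian_conj_tangentBasis (ambientHessian_isSymm hR c y))
    (fun y => (hdet y y.2).ne') (x₀ := ⟨x₀, hx₀⟩) h₀ ⟨x, hx⟩
  have hcont : Continuous fun y : openSimplex (d + 1) => ambientHessian R c y := by
    unfold ambientHessian
    have hQ (y : openSimplex (d + 1)) : (y : Fin (d + 1) → ℝ) ⬝ᵥ R *ᵥ y ≠ 0 :=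
      (dotProduct_mulVec_pos hnn hpos y.2.1).ne'
    have hQc : Continuous fun y : openSimplex (d + 1) => (y : Fin (d + 1) → ℝ) ⬝ᵥ R *ᵥ y := by
      fun_prop
    have h1 : Continuous fun y : openSimplex (d + 1) => fun i => ((y : Fin (d + 1) → ℝ) i)⁻¹ :=
      continuous_pi fun i =>
        ((continuous_apply i).comp continuous_subtype_val).inv₀ fun y => (y.2.1 i).ne'
    have h2 : Continuous fun y : openSimplex (d + 1) =>
        Matrix.vecMulVec (R *ᵥ (y : Fin (d + 1) → ℝ)) ((y : Fin (d + 1) → ℝ) ᵥ* R) := by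
      fun_prop
    exact h1.matrix_diagonal.add ((continuous_const.div hQc hQ).smul
      (((continuous_const.div hQc hQ).smul h2).sub continuous_const))
  exact (continuous_const.matrix_mul hcont).matrix_mul continuous_const

theorem mulVec_const {n : Type*} [Fintype n] {R : Matrix n n ℝ} {μ : ℝ}
    (hrow : R *ᵥ (fun _ => 1) = fun _ => μ) (a : ℝ) : R *ᵥ (fun _ => a) = fun _ => a * μ := by
  have : (fun _ : n => a) = a • fun _ => (1 : ℝ) := by ext; simp
  rw [this, Matrix.mulVec_smul, hrow]
  rfl

/-- The entropy inequality inside the simplex: along a segment from the barycentre, the function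
`∑ i, x i * log (x i) - c * log (xᵀ R x)` is convex, and its derivative at the barycentre is `0`
because `R` has constant row sums. -/
theorem mul_log_normForm_le_relEntropy {d : ℕ} {R : Matrix (Fin (d + 1)) (Fin (d + 1)) ℝ}
    (hR : R.IsSymm) (hnn : ∀ i j, 0 ≤ R i j) (hpos : ∃ i j, 0 < R i j) {μ : ℝ} (hμ : 0 < μ)
    (hrow : R *ᵥ (fun _ => 1) = fun _ => μ) {c : ℝ}
    (hform : ∀ x ∈ openSimplex (d + 1), ∀ z : Fin (d + 1) → ℝ, ∑ i, z i = 0 →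
      0 ≤ hessianForm R c x z) {x : Fin (d + 1) → ℝ} (hx : x ∈ openSimplex (d + 1)) :
    c * Real.log (normForm R μ x) ≤ relEntropy x := by
  have hd : (0 : ℝ) < d + 1 := by positivity
  set a : ℝ := 1 / (d + 1) with ha
  set y : Fin (d + 1) → ℝ := fun i => x i - a with hy
  have hysum : ∑ i, y i = 0 := by
    simp only [hy, Finset.sum_sub_distrib, hx.2]
    simp [ha]
    field_simp
    simp
  set p : ℝ → Fin (d + 1) → ℝ := fun t => (fun _ => a) + t • y with hp
  have hp1 : p 1 = x := by ext i; simp [hp, hy]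
  have hp0 : p 0 = fun _ => a := by ext i; simp [hp]
  have hmem (t : ℝ) (ht : t ∈ Set.Icc (0 : ℝ) 1) : p t ∈ openSimplex (d + 1) := by
    have := convex_openSimplex (d + 1) (barycentre_mem_openSimplex d) hx (sub_nonneg.2 ht.2) ht.1
      (by ring)
    convert this using 1
    ext i
    simp [hp, hy, ha]
    ring
  have hQ (t : ℝ) (ht : t ∈ Set.Icc (0 : ℝ) 1) : 0 < p t ⬝ᵥ R *ᵥ p t :=
    dotProduct_mulVec_pos hnn hpos (hmem t ht).1
  have hpd (i) (t : ℝ) : HasDerivAt (fun s => p s i) (y i) t := by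
    have := ((hasDerivAt_id t).mul_const (y i)).const_add a
    simpa [hp] using this
  have hRd (t : ℝ) : HasDerivAt (fun s => y ⬝ᵥ R *ᵥ p s) (y ⬝ᵥ R *ᵥ y) t := by
    have := ((hasDerivAt_id t).mul_const (y ⬝ᵥ R *ᵥ y)).const_add (y ⬝ᵥ R *ᵥ (fun _ => a))
    simpa [hp, Matrix.mulVec_add, Matrix.mulVec_smul] using this
  have hQd (t : ℝ) : HasDerivAt (fun s => p s ⬝ᵥ R *ᵥ p s) (2 * (y ⬝ᵥ R *ᵥ p t)) t := by
    have h : ∀ s, p s ⬝ᵥ R *ᵥ p s = (fun _ => a) ⬝ᵥ R *ᵥ (fun _ => a)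
        + s * (y ⬝ᵥ R *ᵥ (fun _ => a)) + s * (y ⬝ᵥ R *ᵥ p s) := by
      intro s
      simp only [hp, Matrix.mulVec_add, Matrix.mulVec_smul, dotProduct_add, add_dotProduct,
        dotProduct_smul, smul_dotProduct, smul_eq_mul]
      rw [dotProduct_mulVec_comm hR _ y]
    rw [funext h]
    refine ((((hasDerivAt_id t).mul_const _).const_add _).add
      ((hasDerivAt_id t).mul (hRd t))).congr_deriv ?_
    simp [hp, Matrix.mulVec_add, Matrix.mulVec_smul]
    ring
  -- The function along the segment, its derivative `g'`, and its second derivative, which is the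
  -- Hessian form in the direction `y`.
  set g : ℝ → ℝ := fun t => relEntropy (p t) - c * Real.log (normForm R μ (p t)) with hg
  set g' : ℝ → ℝ := fun t => ∑ i, y i * (Real.log ((d + 1) * p t i) + 1)
    - c * (2 * (y ⬝ᵥ R *ᵥ p t) / (p t ⬝ᵥ R *ᵥ p t)) with hg'
  have hgd (t : ℝ) (ht : t ∈ Set.Icc (0 : ℝ) 1) : HasDerivAt g (g' t) t := by
    have hQt := hQ t ht
    refine HasDerivAt.sub ?_ (HasDerivAt.const_mul c ?_)
    · refine HasDerivAt.fun_sum fun i _ => ?_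
      have hpi := (hmem t ht).1 i
      refine ((hpd i t).mul (((hpd i t).const_mul ((d : ℝ) + 1)).log
        (by positivity))).congr_deriv ?_
      field_simp
    · refine (((hQd t).const_mul (((d : ℝ) + 1) / μ)).log (by positivity)).congr_deriv ?_
      field_simp
  have hg'd (t : ℝ) (ht : t ∈ Set.Icc (0 : ℝ) 1) : HasDerivAt g' (hessianForm R c (p t) y) t := by
    have hQt := hQ t ht
    have h1 : HasDerivAt (fun t => ∑ i, y i * (Real.log ((d + 1) * p t i) + 1))
        (∑ i, y i ^ 2 / p t i) t := by
      refine HasDerivAt.fun_sum fun i _ => ?_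
      have hpi := (hmem t ht).1 i
      refine (((((hpd i t).const_mul ((d : ℝ) + 1)).log (by positivity)).add_const 1).const_mul
        (y i)).congr_deriv ?_
      field_simp
    refine (h1.sub ((((hRd t).const_mul 2).div (hQd t) hQt.ne').const_mul c)).congr_deriv ?_
    simp only [hessianForm]
    field_simp
    ring
  have hg'0 : g' 0 = 0 := by
    have h1 : ((d : ℝ) + 1) * a = 1 := by rw [ha]; field_simp
    have h2 : y ⬝ᵥ (fun _ => a * μ) = 0 := by
      simp [dotProduct, ← Finset.sum_mul, hysum]
    simp only [hg', hp0, h1, mulVec_const hrow, h2, Real.log_one]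
    simp [hysum]
  have hg0 : g 0 = 0 := by
    have h1 : ((d : ℝ) + 1) * a = 1 := by rw [ha]; field_simp
    have h2 : normForm R μ (fun _ => a) = 1 := by
      simp [normForm, mulVec_const hrow, dotProduct, ha]
      field_simp
    simp [hg, hp0, relEntropy, h1, h2]
  have hmono' : MonotoneOn g' (Set.Icc 0 1) := by
    refine monotoneOn_of_deriv_nonneg (convex_Icc 0 1)
      (fun t ht => (hg'd t ht).continuousAt.continuousWithinAt)
      (fun t ht => (hg'd t (interior_subset ht)).differentiableAt.differentiableWithinAt)
      fun t ht => ?_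
    rw [(hg'd t (interior_subset ht)).deriv]
    exact hform _ (hmem t (interior_subset ht)) y hysum
  have hmono : MonotoneOn g (Set.Icc 0 1) := by
    refine monotoneOn_of_deriv_nonneg (convex_Icc 0 1)
      (fun t ht => (hgd t ht).continuousAt.continuousWithinAt)
      (fun t ht => (hgd t (interior_subset ht)).differentiableAt.differentiableWithinAt)
      fun t ht => ?_
    have ht' := interior_subset ht
    rw [(hgd t ht').deriv, ← hg'0]
    exact hmono' (Set.left_mem_Icc.2 zero_le_one) ht' ht'.1
  have := hmono (Set.left_mem_Icc.2 zero_le_one) (Set.right_mem_Icc.2 zero_le_one) zero_le_one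
  rw [hg0] at this
  simp only [hg, hp1] at this
  linarith

/-- The entropy inequality extends to the closed simplex by continuity. -/
theorem entropyBound_of_openSimplex {d : ℕ} {R : Matrix (Fin (d + 1)) (Fin (d + 1)) ℝ}
    (hnn : ∀ i j, 0 ≤ R i j) (hpos : ∃ i j, 0 < R i j) {μ : ℝ} (hμ : 0 < μ) {c : ℝ} (hc : 0 < c)
    (h : ∀ x ∈ openSimplex (d + 1), c * Real.log (normForm R μ x) ≤ relEntropy x) :
    EntropyBound R μ c := by
  intro x hx hx1
  set p : ℝ → Fin (d + 1) → ℝ := fun t => (1 - t) • x + t • fun _ => 1 / ((d : ℝ) + 1) with hp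
  have hpc : Continuous p := by fun_prop
  have hp0 : p 0 = x := by simp [hp]
  have h1 : Tendsto (fun t => normForm R μ (p t) ^ c) (𝓝[>] 0) (𝓝 (normForm R μ x ^ c)) := by
    have : Continuous fun t => normForm R μ (p t) ^ c :=
      ((continuous_normForm R μ).comp hpc).rpow_const fun _ => Or.inr hc.le
    rw [← hp0]
    exact (this.tendsto 0).mono_left nhdsWithin_le_nhds
  have h2 : Tendsto (fun t => Real.exp (relEntropy (p t))) (𝓝[>] 0)
      (𝓝 (Real.exp (relEntropy x))) := by
    have : Continuous fun t => Real.exp (relEntropy (p t)) :=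
      Real.continuous_exp.comp (continuous_relEntropy.comp hpc)
    rw [← hp0]
    exact (this.tendsto 0).mono_left nhdsWithin_le_nhds
  refine le_of_tendsto_of_tendsto h1 h2 ?_
  filter_upwards [Ioo_mem_nhdsGT (zero_lt_one' ℝ)] with t ht
  have hmem : p t ∈ openSimplex (d + 1) := by
    refine ⟨fun i => ?_, ?_⟩
    · have : 0 < (1 - t) * x i + t * (1 / ((d : ℝ) + 1)) := by
        have h3 : 0 ≤ (1 - t) * x i := mul_nonneg (by linarith [ht.2]) (hx i)
        have h4 : 0 < t * (1 / ((d : ℝ) + 1)) := mul_pos ht.1 (by positivity)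
        linarith
      simpa [hp] using this
    · have h5 := (barycentre_mem_openSimplex d).2
      simp only [hp, Pi.add_apply, Pi.smul_apply, smul_eq_mul, Finset.sum_add_distrib,
        ← Finset.mul_sum, hx1, h5]
      ring
  have hQ : 0 < normForm R μ (p t) := by
    have := dotProduct_mulVec_pos hnn hpos hmem.1
    unfold normForm
    positivity
  rw [Real.rpow_def_of_pos hQ, mul_comm]
  exact Real.exp_le_exp.2 (h _ hmem)

theorem entropyBound_of_det_pos {d : ℕ} {R : Matrix (Fin (d + 1)) (Fin (d + 1)) ℝ}
    (hR : R.IsSymm) (hnn : ∀ i j, 0 ≤ R i j) (hpos : ∃ i j, 0 < R i j) {μ : ℝ} (hμ : 0 < μ)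
    (hrow : R *ᵥ (fun _ => 1) = fun _ => μ) {c : ℝ} (hc : 0 < c)
    (hdet : ∀ x ∈ openSimplex (d + 1), 0 < (hessian R c x).det) : EntropyBound R μ c :=
  entropyBound_of_openSimplex hnn hpos hμ hc fun _ hx =>
    mul_log_normForm_le_relEntropy hR hnn hpos hμ hrow (fun _ hx' _ hz =>
      hessianForm_nonneg_of_posDef hR (posDef_hessian_of_det_pos hR hnn hpos hc hdet hx') hz) hx

/-! ### Counting graphs by the numbers of vertices of each type -/

/-- The number of vertices of each type. -/
def typeCount {q n : ℕ} (t : Fin n → Fin q) (i : Fin q) : ℕ :=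
  (Finset.univ.filter fun v => t v = i).card

theorem sum_comp_type {q n : ℕ} (t : Fin n → Fin q) (h : Fin q → ℝ) :
    ∑ v, h (t v) = ∑ i, (typeCount t i : ℝ) * h i := by
  rw [← Finset.sum_fiberwise' Finset.univ t h]
  simp [typeCount]

/-- A sum over edge multisets weighted by `seqv` is a sum over sequences of ordered pairs. -/
theorem sum_seqv_mul_prod {q n m : ℕ} (R : Matrix (Fin q) (Fin q) ℝ) (hR : R.IsSymm)
    (t : Fin n → Fin q) :
    ∑ e : Sym (Sym2 (Fin n)) m,
        (seqv e : ℝ) * ((e : Multiset (Sym2 (Fin n))).map (edgeWeight R hR t)).prod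
      = ((fun i => (typeCount t i : ℝ)) ⬝ᵥ R *ᵥ fun i => (typeCount t i : ℝ)) ^ m := by
  classical
  obtain ⟨Φ, hΦ⟩ : ∃ Φ : (Fin m → Fin n × Fin n) → Sym (Sym2 (Fin n)) m, ∀ p,
      (Φ p : Multiset (Sym2 (Fin n))) = Finset.univ.val.map (fun i => s((p i).1, (p i).2)) :=
    ⟨fun p => ⟨Finset.univ.val.map (fun i => s((p i).1, (p i).2)), by simp⟩, fun p => rfl⟩
  have hseqv (e : Sym (Sym2 (Fin n)) m) :
      seqv e = (Finset.univ.filter fun p => Φ p = e).card := by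
    rw [seqv, Nat.card_eq_fintype_card, Fintype.card_subtype]
    congr 1
    ext p
    rw [Finset.mem_filter_univ, Finset.mem_filter_univ, ← hΦ, Sym.coe_inj]
  have hsum : ∑ p : Fin n × Fin n, R (t p.1) (t p.2)
      = (fun i => (typeCount t i : ℝ)) ⬝ᵥ R *ᵥ fun i => (typeCount t i : ℝ) := by
    rw [Fintype.sum_prod_type]
    have h (v : Fin n) : ∑ w, R (t v) (t w) = ∑ j, (typeCount t j : ℝ) * R (t v) j :=
      sum_comp_type t fun j => R (t v) j
    simp_rw [h]
    rw [sum_comp_type t fun i => ∑ j, (typeCount t j : ℝ) * R i j]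
    simp [dotProduct, Matrix.mulVec, mul_comm]
  rw [← hsum, Fintype.sum_pow]
  rw [← Finset.sum_fiberwise Finset.univ Φ]
  refine Finset.sum_congr rfl fun e _ => ?_
  rw [hseqv, ← nsmul_eq_mul, ← Finset.sum_const]
  refine Finset.sum_congr rfl fun p hp => ?_
  rw [Finset.mem_filter_univ] at hp
  rw [← hp, hΦ, Multiset.map_map]
  rfl

/-- The number of type assignments with prescribed counts is a multinomial coefficient. -/
theorem card_filter_typeCount {q n : ℕ} (k : Fin q → ℕ) (hk : ∑ i, k i = n) :
    (Finset.univ.filter fun t : Fin n → Fin q => typeCount t = k).card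
      = Nat.multinomial Finset.univ k := by
  classical
  -- Compare the coefficients of two expansions of `(∑ i, X i) ^ n`.
  have h1 : (∑ i, (MvPolynomial.X i : MvPolynomial (Fin q) ℕ)) ^ n
      = ∑ t : Fin n → Fin q,
          MvPolynomial.monomial (Finsupp.equivFunOnFinite.symm (typeCount t)) 1 := by
    rw [Fintype.sum_pow]
    refine Finset.sum_congr rfl fun t _ => ?_
    rw [MvPolynomial.monomial_eq, ← Finset.prod_fiberwise' Finset.univ t MvPolynomial.X]
    simp [typeCount, Finsupp.prod_fintype]
  have h2 : (∑ i, (MvPolynomial.X i : MvPolynomial (Fin q) ℕ)) ^ n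
      = ∑ k ∈ Finset.piAntidiag Finset.univ n, MvPolynomial.monomial
          (Finsupp.equivFunOnFinite.symm k) (Nat.multinomial Finset.univ k) := by
    rw [Finset.sum_pow_eq_sum_piAntidiag]
    refine Finset.sum_congr rfl fun k _ => ?_
    rw [MvPolynomial.monomial_eq]
    simp [Finsupp.prod_fintype]
  have h3 := congrArg (MvPolynomial.coeff (Finsupp.equivFunOnFinite.symm k)) (h1.symm.trans h2)
  simp only [MvPolynomial.coeff_sum, MvPolynomial.coeff_monomial,
    EmbeddingLike.apply_eq_iff_eq] at h3
  rw [Finset.sum_boole, Finset.sum_ite_eq', if_pos (by simp [hk])] at h3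
  exact_mod_cast h3

theorem sum_typeCount {q n : ℕ} (t : Fin n → Fin q) : ∑ i, typeCount t i = n := by
  have := Finset.card_eq_sum_card_fiberwise (f := t) (s := Finset.univ) (t := Finset.univ)
    (fun _ _ => Finset.mem_univ _)
  simpa [typeCount] using this.symm

/-- The weighted number of graphs, grouped by the numbers of vertices of each type. -/
theorem numGraphs_eq_sum_multinomial {q : ℕ} (R : Matrix (Fin q) (Fin q) ℝ) (hR : R.IsSymm)
    (n m : ℕ) :
    numGraphs R hR (fun _ => 1) n m = (∑ k ∈ Finset.piAntidiag Finset.univ n,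
      (Nat.multinomial Finset.univ k : ℝ) * ((fun i => (k i : ℝ)) ⬝ᵥ R *ᵥ fun i => (k i : ℝ)) ^ m)
        / (2 ^ m * m.factorial) := by
  classical
  have h1 : numGraphs R hR (fun _ => 1) n m = ∑ t : Fin n → Fin q,
      ((fun i => (typeCount t i : ℝ)) ⬝ᵥ R *ᵥ fun i => (typeCount t i : ℝ)) ^ m
        / (2 ^ m * m.factorial) := by
    rw [numGraphs, ← (TypedGraph.equivProd q n m).symm.sum_comp, Fintype.sum_prod_type]
    refine Finset.sum_congr rfl fun t _ => ?_
    rw [← sum_seqv_mul_prod R hR t, Finset.sum_div]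
    refine Finset.sum_congr rfl fun e _ => ?_
    simp only [TypedGraph.weight, TypedGraph.equivProd, compensation, Equiv.coe_fn_symm_mk,
      Finset.prod_const_one, mul_one]
    ring
  rw [h1, ← Finset.sum_div]
  congr 1
  rw [← Finset.sum_fiberwise_of_maps_to (s := Finset.univ) (t := Finset.piAntidiag Finset.univ n)
    (g := typeCount) (fun t _ => by simp [sum_typeCount])]
  refine Finset.sum_congr rfl fun k hk => ?_
  rw [← card_filter_typeCount k (by simpa using hk), ← nsmul_eq_mul, ← Finset.sum_const]
  refine Finset.sum_congr rfl fun t ht => ?_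
  rw [Finset.mem_filter_univ] at ht
  rw [← ht]

/-! ### Local estimates for multinomial probabilities -/

/-- The empirical distribution of a vector of counts with sum `n`. -/
noncomputable def empirical {d : ℕ} (n : ℕ) (k : Fin (d + 1) → ℕ) (i : Fin (d + 1)) : ℝ := k i / n

/-- The probability of the vector of counts `k` under the uniform multinomial distribution. -/
noncomputable def multinomialProb {d : ℕ} (n : ℕ) (k : Fin (d + 1) → ℕ) : ℝ :=
  (Nat.multinomial Finset.univ k : ℝ) / ((d : ℝ) + 1) ^ n

theorem empirical_nonneg {d : ℕ} (n : ℕ) (k : Fin (d + 1) → ℕ) (i) : 0 ≤ empirical n k i := by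
  unfold empirical
  positivity

theorem sum_empirical {d n : ℕ} (hn : n ≠ 0) {k : Fin (d + 1) → ℕ} (hk : ∑ i, k i = n) :
    ∑ i, empirical n k i = 1 := by
  have : (n : ℝ) ≠ 0 := by exact_mod_cast hn
  simp only [empirical]
  rw [← Finset.sum_div, ← Nat.cast_sum, hk, div_self this]

theorem exp_mul_relEntropy_empirical {d n : ℕ} (hn : n ≠ 0) {k : Fin (d + 1) → ℕ}
    (hk : ∑ i, k i = n) : Real.exp (n * relEntropy (empirical n k))
      = ((d : ℝ) + 1) ^ n * ∏ i, empirical n k i ^ k i := by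
  have hn' : (n : ℝ) ≠ 0 := by exact_mod_cast hn
  have h (i) : Real.exp (n * (empirical n k i * Real.log ((d + 1) * empirical n k i)))
      = ((d : ℝ) + 1) ^ k i * empirical n k i ^ k i := by
    rcases Nat.eq_zero_or_pos (k i) with h0 | h0
    · simp [empirical, h0]
    · have hpos : 0 < empirical n k i := by unfold empirical; positivity
      rw [← mul_pow, ← Real.exp_log (show 0 < ((d : ℝ) + 1) * empirical n k i by positivity),
        ← Real.exp_nat_mul, Real.log_exp]
      congr 1
      nth_rw 1 [empirical]
      field_simp
  rw [relEntropy, Finset.mul_sum, Real.exp_sum, Finset.prod_congr rfl fun i _ => h i,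
    Finset.prod_mul_distrib, Finset.prod_pow_eq_pow_sum, hk]

theorem multinomialProb_nonneg {d : ℕ} (n : ℕ) (k : Fin (d + 1) → ℕ) : 0 ≤ multinomialProb n k := by
  unfold multinomialProb
  positivity

theorem multinomialProb_mul_exp {d n : ℕ} (hn : n ≠ 0) {k : Fin (d + 1) → ℕ}
    (hk : ∑ i, k i = n) : multinomialProb n k * Real.exp (n * relEntropy (empirical n k))
      = Nat.multinomial Finset.univ k * ∏ i, empirical n k i ^ k i := by
  rw [exp_mul_relEntropy_empirical hn hk, multinomialProb]
  field_simp

/-- The method of types: one term of the multinomial expansion of `(∑ i, k i / n) ^ n = 1`. -/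
theorem multinomialProb_le_exp {d n : ℕ} (hn : n ≠ 0) {k : Fin (d + 1) → ℕ}
    (hk : ∑ i, k i = n) : multinomialProb n k ≤ Real.exp (-(n * relEntropy (empirical n k))) := by
  rw [Real.exp_neg, ← one_div, le_div_iff₀ (Real.exp_pos _), multinomialProb_mul_exp hn hk]
  have h := Finset.sum_pow_eq_sum_piAntidiag Finset.univ (empirical n k) n
  rw [sum_empirical hn hk, one_pow] at h
  rw [h]
  refine Finset.single_le_sum (f := fun k' : Fin (d + 1) → ℕ =>
    (Nat.multinomial Finset.univ k' : ℝ) * ∏ i, empirical n k i ^ k' i) (fun k' _ => ?_)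
    (by simp [hk])
  have := Finset.prod_nonneg fun i (_ : i ∈ Finset.univ) =>
    pow_nonneg (empirical_nonneg n k i) (k' i)
  positivity

theorem factorial_eq_stirlingSeq {n : ℕ} (hn : n ≠ 0) : (n.factorial : ℝ)
    = Stirling.stirlingSeq n * (√(2 * n) * (n / Real.exp 1) ^ n) := by
  have : (0 : ℝ) < n := by exact_mod_cast Nat.pos_of_ne_zero hn
  rw [Stirling.stirlingSeq, div_mul_cancel₀]
  positivity

theorem stirlingSeq_pos {n : ℕ} (hn : n ≠ 0) : 0 < Stirling.stirlingSeq n :=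
  (Real.sqrt_pos.2 Real.pi_pos).trans_le (Stirling.sqrt_pi_le_stirlingSeq hn)

theorem stirlingSeq_le_one {n : ℕ} (hn : n ≠ 0) :
    Stirling.stirlingSeq n ≤ Stirling.stirlingSeq 1 := by
  obtain ⟨k, rfl⟩ := Nat.exists_eq_succ_of_ne_zero hn
  exact Stirling.stirlingSeq'_antitone (Nat.zero_le k)

/-- Stirling's formula for the multinomial distribution, with the error kept in `stirlingSeq`. -/
theorem sqrt_pow_mul_multinomialProb {d n : ℕ} {k : Fin (d + 1) → ℕ} (hk : ∑ i, k i = n)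
    (hk0 : ∀ i, k i ≠ 0) : √n ^ d * multinomialProb n k
      = Real.exp (-(n * relEntropy (empirical n k))) * (√2 * Stirling.stirlingSeq n /
        ∏ i, (Stirling.stirlingSeq (k i) * √(2 * empirical n k i))) := by
  have hkpos (i) : (0 : ℝ) < k i := by exact_mod_cast Nat.pos_of_ne_zero (hk0 i)
  have hn : n ≠ 0 := by
    rintro rfl
    exact hk0 0 (by simpa using Finset.sum_eq_zero_iff.1 hk 0)
  have hn' : (0 : ℝ) < n := by exact_mod_cast Nat.pos_of_ne_zero hn
  have hfac : (∏ i, ((k i).factorial : ℝ)) * Nat.multinomial Finset.univ k = n.factorial := by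
    have := Nat.multinomial_spec Finset.univ k
    rw [hk] at this
    exact_mod_cast this
  have hexp : ∏ i, (Real.exp 1) ^ (k i) = Real.exp 1 ^ n := by
    rw [Finset.prod_pow_eq_pow_sum, hk]
  have hnn : ∏ i, (n : ℝ) ^ (k i) = (n : ℝ) ^ n := by
    rw [Finset.prod_pow_eq_pow_sum, hk]
  set S := ∏ i, Stirling.stirlingSeq (k i) with hS
  have hS0 : 0 < S := Finset.prod_pos fun i _ => stirlingSeq_pos (hk0 i)
  set P := ∏ i, (k i : ℝ) ^ k i with hP
  have hP0 : 0 < P := Finset.prod_pos fun i _ => pow_pos (hkpos i) _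
  set T := ∏ i, √(2 * (k i : ℝ)) with hT
  have hT0 : 0 < T := Finset.prod_pos fun i _ => Real.sqrt_pos.2 (by have := hkpos i; positivity)
  have e1 : ∏ i, ((k i).factorial : ℝ) = S * (T * (P / Real.exp 1 ^ n)) := by
    rw [hS, hT, hP, ← hexp, ← Finset.prod_div_distrib, ← Finset.prod_mul_distrib,
      ← Finset.prod_mul_distrib]
    exact Finset.prod_congr rfl fun i _ => by rw [factorial_eq_stirlingSeq (hk0 i), div_pow]
  have e2 : ∏ i, empirical n k i ^ k i = P / (n : ℝ) ^ n := by
    rw [hP, ← hnn, ← Finset.prod_div_distrib]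
    exact Finset.prod_congr rfl fun i _ => by rw [empirical, div_pow]
  have e3 : ∏ i, (Stirling.stirlingSeq (k i) * √(2 * empirical n k i))
      = S * (T / √n ^ (d + 1)) := by
    have : √(n : ℝ) ^ (d + 1) = ∏ _i : Fin (d + 1), √(n : ℝ) := by simp
    rw [hS, hT, this, ← Finset.prod_div_distrib, ← Finset.prod_mul_distrib]
    refine Finset.prod_congr rfl fun i _ => ?_
    rw [empirical, ← Real.sqrt_div (by positivity), mul_div_assoc]
  have e4 := multinomialProb_mul_exp hn hk
  rw [e2] at e4
  rw [e1, factorial_eq_stirlingSeq hn, div_pow, Real.sqrt_mul (by norm_num)] at hfac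
  have hsn : 0 < √(n : ℝ) := Real.sqrt_pos.2 hn'
  rw [e3, Real.exp_neg]
  have hE := Real.exp_pos (n * relEntropy (empirical n k))
  have e5 : multinomialProb n k = Nat.multinomial Finset.univ k * (P / (n : ℝ) ^ n)
      / Real.exp (n * relEntropy (empirical n k)) := by
    rw [eq_div_iff hE.ne', e4]
  have e6 : (Nat.multinomial Finset.univ k : ℝ) =
      Stirling.stirlingSeq n * (√2 * √n * (n ^ n / Real.exp 1 ^ n)) /
        (S * (T * (P / Real.exp 1 ^ n))) := by
    rw [eq_div_iff (by positivity), ← hfac]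
    ring
  rw [e5, e6]
  field_simp
  ring

/-- `√n ^ d * exp (-κ n)` is bounded. -/
theorem exists_sqrt_pow_mul_exp_le (d : ℕ) {κ : ℝ} (hκ : 0 < κ) :
    ∃ C > 0, ∀ n : ℕ, n ≠ 0 → √(n : ℝ) ^ d * Real.exp (-(κ * n)) ≤ C := by
  refine ⟨d.factorial / κ ^ d, by positivity, fun n hn => ?_⟩
  have hn1 : (1 : ℝ) ≤ n := by exact_mod_cast Nat.one_le_iff_ne_zero.2 hn
  have h1 : √(n : ℝ) ≤ n := Real.sqrt_le_iff.2 ⟨by linarith, by nlinarith⟩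
  have h2 := Real.pow_div_factorial_le_exp (κ * n) (by positivity) d
  rw [div_le_iff₀ (by positivity), mul_pow] at h2
  rw [Real.exp_neg, ← div_eq_mul_inv, div_le_div_iff₀ (Real.exp_pos _) (by positivity)]
  calc √(n : ℝ) ^ d * κ ^ d ≤ n ^ d * κ ^ d := by gcongr
    _ ≤ _ := by linarith

/-- The scaled multinomial probabilities, weighted by a power `< 1` of their exponential rate, have
Gaussian tails. Stirling's formula is used where all counts are at least half of their mean; the
entropy is bounded below elsewhere. -/
theorem exists_multinomialProb_mul_exp_le (d : ℕ) {θ : ℝ} (hθ : θ < 1) :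
    ∃ C > 0, ∃ η > 0, ∀ (n : ℕ) (k : Fin (d + 1) → ℕ), n ≠ 0 → ∑ i, k i = n →
      √n ^ d * (multinomialProb n k * Real.exp (θ * (n * relEntropy (empirical n k))))
        ≤ C * Real.exp (-(η * (n * ∑ i, (empirical n k i - 1 / (d + 1)) ^ 2))) := by
  set a : ℝ := 1 / (d + 1) with ha
  have ha0 : 0 < a := by positivity
  obtain ⟨C₁, hC₁, h₁⟩ := exists_sqrt_pow_mul_exp_le d
    (κ := (1 - θ) * (a ^ 2 / 32)) (mul_pos (by linarith) (by positivity))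
  set C₂ : ℝ := √2 * Stirling.stirlingSeq 1 / (√Real.pi * √a) ^ (d + 1) with hC₂
  have hs1 := stirlingSeq_pos one_ne_zero
  have hC₂0 : 0 < C₂ := by have := Real.pi_pos; positivity
  refine ⟨max C₁ C₂, lt_max_of_lt_left hC₁, (1 - θ) / 8, by linarith, fun n k hn hk => ?_⟩
  have hn' : (0 : ℝ) < n := by exact_mod_cast Nat.pos_of_ne_zero hn
  set x := empirical n k with hx
  set D := relEntropy x with hD
  set V := ∑ i, (x i - a) ^ 2 with hV
  have hV0 : 0 ≤ V := Finset.sum_nonneg fun i _ => sq_nonneg _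
  have hDV : 1 / 4 * V ≤ D := sum_sq_sub_le_relEntropy (empirical_nonneg n k) (sum_empirical hn hk)
  have hnV : 0 ≤ n * V := by positivity
  have hnDV : 1 / 4 * (n * V) ≤ n * D := by nlinarith
  by_cases hcentral : ∀ i, a / 2 ≤ x i
  · have hk0 (i) : k i ≠ 0 := by
      intro h
      have := hcentral i
      simp [hx, empirical, h] at this
      linarith
    rw [← mul_assoc, sqrt_pow_mul_multinomialProb hk hk0, mul_assoc, mul_comm _ (Real.exp (θ * _)),
      ← mul_assoc, ← Real.exp_add, mul_comm]
    refine mul_le_mul ?_ (Real.exp_le_exp.2 ?_) (Real.exp_pos _).le (by positivity)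
    · refine le_trans ?_ (le_max_right _ _)
      have hprod : (√Real.pi * √a) ^ (d + 1)
          ≤ ∏ i, (Stirling.stirlingSeq (k i) * √(2 * empirical n k i)) := by
        have : (√Real.pi * √a) ^ (d + 1) = ∏ _i : Fin (d + 1), (√Real.pi * √a) := by simp
        rw [this]
        refine Finset.prod_le_prod (fun i _ => by positivity) fun i _ => ?_
        refine mul_le_mul (Stirling.sqrt_pi_le_stirlingSeq (hk0 i)) (Real.sqrt_le_sqrt ?_)
          (by positivity) (stirlingSeq_pos (hk0 i)).le
        have := hcentral i
        rw [hx] at this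
        linarith
      have hpi : 0 < (√Real.pi * √a) ^ (d + 1) := by have := Real.pi_pos; positivity
      rw [hC₂]
      have := stirlingSeq_le_one hn
      gcongr
    · nlinarith
  · push Not at hcentral
    obtain ⟨i, hi⟩ := hcentral
    have hVa : a ^ 2 / 4 ≤ V := by
      refine le_trans ?_ (Finset.single_le_sum (fun j _ => sq_nonneg (x j - a)) (Finset.mem_univ i))
      nlinarith
    have hnVa : n * (a ^ 2 / 4) ≤ n * V := by gcongr
    calc √n ^ d * (multinomialProb n k * Real.exp (θ * (n * D)))
        ≤ √n ^ d * (Real.exp (-(n * D)) * Real.exp (θ * (n * D))) := by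
          have := multinomialProb_le_exp hn hk
          gcongr
      _ ≤ √n ^ d * (Real.exp (-((1 - θ) * (a ^ 2 / 32) * n)) *
            Real.exp (-((1 - θ) / 8 * (n * V)))) := by
          rw [← Real.exp_add, ← Real.exp_add]
          refine mul_le_mul_of_nonneg_left (Real.exp_le_exp.2 ?_) (by positivity)
          have : 0 ≤ n * D - n * (a ^ 2 / 32) - 1 / 8 * (n * V) := by linarith
          nlinarith [mul_nonneg (sub_nonneg.2 hθ.le) this]
      _ ≤ _ := by
          rw [← mul_assoc]
          gcongr
          exact (h₁ n hn).trans (le_max_left _ _)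

/-! ### Expansions at the barycentre -/

theorem tendsto_mul_log_one_add {ι : Type*} {l : Filter ι} {N ε : ι → ℝ} {w : ℝ}
    (hε : Tendsto ε l (𝓝 0)) (hN : Tendsto (fun j => N j * ε j) l (𝓝 w)) :
    Tendsto (fun j => N j * Real.log (1 + ε j)) l (𝓝 w) := by
  have h1 : Tendsto (fun j => 2 * |N j * ε j| * |ε j|) l (𝓝 0) := by
    simpa using (hN.abs.const_mul 2).mul hε.abs
  have h2 : Tendsto (fun j => N j * Real.log (1 + ε j) - N j * ε j) l (𝓝 0) := by
    refine squeeze_zero_norm' ?_ h1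
    have hsmall : ∀ᶠ j in l, |ε j| < 1 / 2 := by
      have := hε.abs
      rw [abs_zero] at this
      exact this.eventually_lt_const (by norm_num)
    filter_upwards [hsmall] with j hj
    have h := Real.abs_log_sub_add_sum_range_le (x := -ε j) (by rw [abs_neg]; linarith) 1
    simp only [Finset.sum_range_one, abs_neg, sub_neg_eq_add] at h
    norm_num at h
    have h3 : |ε j| ^ 2 / (1 - |ε j|) ≤ 2 * |ε j| ^ 2 := by
      rw [div_le_iff₀ (by linarith)]
      nlinarith [sq_nonneg (|ε j|)]
    rw [← sq_abs] at h
    rw [Real.norm_eq_abs, ← mul_sub, abs_mul, abs_mul]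
    have h4 : |Real.log (1 + ε j) - ε j| ≤ 2 * |ε j| ^ 2 := by
      rw [sub_eq_neg_add]
      exact h.trans h3
    nlinarith [abs_nonneg (N j)]
  simpa using h2.add hN

theorem tendsto_mul_entropy_one_add {ι : Type*} {l : Filter ι} {N τ : ι → ℝ} {w : ℝ}
    (hτ : Tendsto τ l (𝓝 0)) (hN : Tendsto (fun j => N j * τ j ^ 2) l (𝓝 w)) :
    Tendsto (fun j => N j * ((1 + τ j) * Real.log (1 + τ j) - τ j)) l (𝓝 (w / 2)) := by
  have h1 : Tendsto (fun j => 4 * |N j * τ j ^ 2| * |τ j|) l (𝓝 0) := by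
    simpa using (hN.abs.const_mul 4).mul hτ.abs
  have h2 : Tendsto (fun j => N j * ((1 + τ j) * Real.log (1 + τ j) - τ j) - N j * τ j ^ 2 / 2) l
      (𝓝 0) := by
    refine squeeze_zero_norm' ?_ h1
    have hsmall : ∀ᶠ j in l, |τ j| < 1 / 2 := by
      have := hτ.abs
      rw [abs_zero] at this
      exact this.eventually_lt_const (by norm_num)
    filter_upwards [hsmall] with j hj
    have h := Real.abs_log_sub_add_sum_range_le (x := -τ j) (by rw [abs_neg]; linarith) 2
    simp only [Finset.sum_range_succ, Finset.sum_range_zero, abs_neg, sub_neg_eq_add] at h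
    norm_num at h
    have h3 : |τ j| ^ 3 / (1 - |τ j|) ≤ 2 * |τ j| ^ 3 := by
      rw [div_le_iff₀ (by linarith)]
      nlinarith [pow_nonneg (abs_nonneg (τ j)) 3]
    set r := -τ j + τ j ^ 2 / 2 + Real.log (1 + τ j) with hr
    have h4 : (1 + τ j) * Real.log (1 + τ j) - τ j - τ j ^ 2 / 2
        = -(τ j ^ 3 / 2) + (1 + τ j) * r := by rw [hr]; ring
    have h5 : |(1 + τ j) * Real.log (1 + τ j) - τ j - τ j ^ 2 / 2| ≤ 4 * |τ j| ^ 3 := by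
      rw [h4]
      refine (abs_add_le _ _).trans ?_
      rw [abs_neg, abs_div, abs_pow, abs_mul]
      have h6 : |1 + τ j| ≤ 3 / 2 := (abs_add_le _ _).trans (by rw [abs_one]; linarith)
      have h7 : |1 + τ j| * |r| ≤ 3 / 2 * (2 * |τ j| ^ 3) :=
        mul_le_mul h6 (h.trans h3) (abs_nonneg _) (by norm_num)
      have h8 : |(2 : ℝ)| = 2 := by norm_num
      rw [h8]
      linarith [pow_nonneg (abs_nonneg (τ j)) 3]
    rw [Real.norm_eq_abs, mul_div_assoc, ← mul_sub, abs_mul, abs_mul, abs_pow]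
    nlinarith [abs_nonneg (N j)]
  have := h2.add (hN.div_const 2)
  simpa using this

theorem normForm_barycentre_add {d : ℕ} {R : Matrix (Fin (d + 1)) (Fin (d + 1)) ℝ}
    (hR : R.IsSymm) {μ : ℝ} (hμ : 0 < μ) (hrow : R *ᵥ (fun _ => 1) = fun _ => μ)
    {y : Fin (d + 1) → ℝ} (hy : ∑ i, y i = 0) :
    normForm R μ (fun i => 1 / (d + 1) + y i) = 1 + (d + 1) / μ * (y ⬝ᵥ R *ᵥ y) := by
  have h : (fun i => 1 / ((d : ℝ) + 1) + y i) = (fun _ => 1 / ((d : ℝ) + 1)) + y := rfl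
  have h0 : y ⬝ᵥ (fun _ => 1 / ((d : ℝ) + 1) * μ) = 0 := by
    simp only [dotProduct]
    rw [← Finset.sum_mul, hy, zero_mul]
  rw [h, normForm]
  simp only [Matrix.mulVec_add, dotProduct_add, add_dotProduct]
  rw [dotProduct_mulVec_comm hR _ y, mulVec_const hrow, h0]
  simp [dotProduct]
  field_simp

theorem relEntropy_barycentre_add {d : ℕ} {y : Fin (d + 1) → ℝ} (hy : ∑ i, y i = 0) :
    relEntropy (fun i => 1 / (d + 1) + y i) = ∑ i, 1 / ((d : ℝ) + 1) *
      ((1 + (d + 1) * y i) * Real.log (1 + (d + 1) * y i) - (d + 1) * y i) := by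
  have h : ∑ i, 1 / ((d : ℝ) + 1) * ((d + 1) * y i) = 0 := by
    simp_rw [← Finset.mul_sum, hy, mul_zero]
  simp_rw [mul_sub]
  rw [Finset.sum_sub_distrib, h, sub_zero, relEntropy]
  refine Finset.sum_congr rfl fun i _ => ?_
  rw [mul_add ((d : ℝ) + 1) (1 / (d + 1)) (y i), mul_one_div_cancel (by positivity)]
  field_simp

section Expansion

variable {ι : Type*} {l : Filter ι} {N : ι → ℝ}

theorem tendsto_div_sqrt_zero (hN : Tendsto N l atTop) {s : ι → ℝ} {t : ℝ}
    (hs : Tendsto s l (𝓝 t)) : Tendsto (fun j => s j / √(N j)) l (𝓝 0) :=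
  hs.div_atTop (Real.tendsto_sqrt_atTop.comp hN)

theorem tendsto_mul_relEntropy {d : ℕ} (hN : Tendsto N l atTop) {ζ : ι → Fin (d + 1) → ℝ}
    {z : Fin (d + 1) → ℝ} (hζ0 : ∀ᶠ j in l, ∑ i, ζ j i = 0)
    (hζ : ∀ i, Tendsto (fun j => ζ j i) l (𝓝 (z i))) :
    Tendsto (fun j => N j * relEntropy (fun i => 1 / (d + 1) + ζ j i / √(N j))) l
      (𝓝 ((d + 1) / 2 * ∑ i, z i ^ 2)) := by
  have hterm (i) : Tendsto (fun j => N j * ((1 + (d + 1) * (ζ j i / √(N j))) *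
      Real.log (1 + (d + 1) * (ζ j i / √(N j))) - (d + 1) * (ζ j i / √(N j)))) l
      (𝓝 (((d + 1) * z i) ^ 2 / 2)) := by
    refine tendsto_mul_entropy_one_add ?_ ?_
    · simpa using (tendsto_div_sqrt_zero hN (hζ i)).const_mul ((d : ℝ) + 1)
    · refine (((hζ i).const_mul ((d : ℝ) + 1)).pow 2).congr' ?_
      filter_upwards [hN.eventually_gt_atTop 0] with j hj
      have := Real.sq_sqrt hj.le
      have h0 := Real.sqrt_pos.2 hj
      rw [mul_pow, mul_pow, div_pow, this]
      field_simp
  have := tendsto_finsetSum Finset.univ fun i _ => (hterm i).const_mul (1 / ((d : ℝ) + 1))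
  have hlim : ∑ i, 1 / ((d : ℝ) + 1) * (((d + 1) * z i) ^ 2 / 2) = (d + 1) / 2 * ∑ i, z i ^ 2 := by
    rw [Finset.mul_sum]
    exact Finset.sum_congr rfl fun i _ => by field_simp
  rw [hlim] at this
  refine this.congr' ?_
  filter_upwards [hζ0] with j hj
  rw [relEntropy_barycentre_add (by rw [← Finset.sum_div, hj, zero_div]), Finset.mul_sum]
  exact Finset.sum_congr rfl fun i _ => by ring

/-- With deviations of order `N ^ (-1/2)` from the barycentre, `normForm` is `1 + ε` with
`N ε → (q / μ) zᵀ R z`. -/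
theorem exists_normForm_expansion {d : ℕ} {R : Matrix (Fin (d + 1)) (Fin (d + 1)) ℝ}
    (hR : R.IsSymm) {μ : ℝ} (hμ : 0 < μ) (hrow : R *ᵥ (fun _ => 1) = fun _ => μ)
    (hN : Tendsto N l atTop) {ζ : ι → Fin (d + 1) → ℝ}
    {z : Fin (d + 1) → ℝ} (hζ0 : ∀ᶠ j in l, ∑ i, ζ j i = 0)
    (hζ : ∀ i, Tendsto (fun j => ζ j i) l (𝓝 (z i))) :
    ∃ ε : ι → ℝ, Tendsto ε l (𝓝 0) ∧
      Tendsto (fun j => N j * ε j) l (𝓝 ((d + 1) / μ * (z ⬝ᵥ R *ᵥ z))) ∧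
      ∀ᶠ j in l, normForm R μ (fun i => 1 / (d + 1) + ζ j i / √(N j)) = 1 + ε j := by
  have hq : Tendsto (fun j => (d + 1) / μ * (ζ j ⬝ᵥ R *ᵥ ζ j)) l
      (𝓝 ((d + 1) / μ * (z ⬝ᵥ R *ᵥ z))) := by
    have hcont : Continuous fun z : Fin (d + 1) → ℝ => (d + 1) / μ * (z ⬝ᵥ R *ᵥ z) := by fun_prop
    exact (hcont.tendsto z).comp (tendsto_pi_nhds.2 hζ)
  refine ⟨fun j => (d + 1) / μ * (ζ j ⬝ᵥ R *ᵥ ζ j) / N j, hq.div_atTop hN, hq.congr' ?_, ?_⟩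
  · filter_upwards [hN.eventually_gt_atTop 0] with j hj
    field_simp
  · filter_upwards [hN.eventually_gt_atTop 0, hζ0] with j hj hj0
    rw [normForm_barycentre_add hR hμ hrow (y := fun i => ζ j i / √(N j))
      (by rw [← Finset.sum_div, hj0, zero_div])]
    have h : (fun i => ζ j i / √(N j)) = (√(N j))⁻¹ • ζ j := by
      ext i
      simp [div_eq_inv_mul]
    rw [h, Matrix.mulVec_smul, dotProduct_smul, smul_dotProduct, smul_smul, smul_eq_mul,
      ← mul_inv, Real.mul_self_sqrt hj.le]
    ring

end Expansion

/-- The second-order condition at the barycentre. -/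
theorem EntropyBound.quadratic_le {d : ℕ} {R : Matrix (Fin (d + 1)) (Fin (d + 1)) ℝ}
    (hR : R.IsSymm) {μ : ℝ} (hμ : 0 < μ) (hrow : R *ᵥ (fun _ => 1) = fun _ => μ) {c : ℝ}
    (h : EntropyBound R μ c) {z : Fin (d + 1) → ℝ} (hz : ∑ i, z i = 0) :
    2 * c / μ * (z ⬝ᵥ R *ᵥ z) ≤ ∑ i, z i ^ 2 := by
  have hN := tendsto_natCast_atTop_atTop (R := ℝ)
  have h1 := tendsto_mul_relEntropy (d := d) hN (ζ := fun _ => z) (z := z)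
    (Eventually.of_forall fun _ => hz) (fun i => tendsto_const_nhds)
  obtain ⟨ε, hε0, hε1, hε2⟩ := exists_normForm_expansion hR hμ hrow hN (ζ := fun _ => z) (z := z)
    (Eventually.of_forall fun _ => hz) (fun i => tendsto_const_nhds)
  have h2 := (tendsto_mul_log_one_add hε0 hε1).const_mul c
  have hle := le_of_tendsto_of_tendsto h2 h1 ?_
  · have hd : (0 : ℝ) < d + 1 := by positivity
    have h3 : (d + 1) / 2 * (2 * c / μ * (z ⬝ᵥ R *ᵥ z)) ≤ (d + 1) / 2 * ∑ i, z i ^ 2 := by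
      refine le_trans (le_of_eq ?_) hle
      field_simp
    exact le_of_mul_le_mul_left h3 (by positivity)
  have hpos (i) : ∀ᶠ n : ℕ in atTop, 0 ≤ 1 / ((d : ℝ) + 1) + z i / √(n : ℝ) := by
    have := (tendsto_div_sqrt_zero hN (tendsto_const_nhds (x := z i))).const_add (1 / ((d : ℝ) + 1))
    refine (this.eventually_const_lt (u := 0) ?_).mono fun _ h => h.le
    simp
    positivity
  filter_upwards [eventually_all.2 hpos, hε2, hε0.eventually_const_lt (u := -1) (by norm_num)]
    with n hn hn2 hn3
  have h4 := h _ hn (by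
    rw [Finset.sum_add_distrib, ← Finset.sum_div Finset.univ z, hz, zero_div, add_zero]
    simp
    field_simp)
  rw [hn2] at h4
  have h5 : 0 < 1 + ε n := by linarith
  rw [Real.rpow_def_of_pos h5, Real.exp_le_exp] at h4
  calc c * (n * Real.log (1 + ε n)) = n * (Real.log (1 + ε n) * c) := by ring
    _ ≤ _ := by gcongr

/-! ### The local limit -/

/-- The contribution of the vector of counts `k` to the partition function, scaled by the density
`√n ^ d` of the lattice of the scaled deviations. -/
noncomputable def scaledWeight {d : ℕ} (R : Matrix (Fin (d + 1)) (Fin (d + 1)) ℝ) (μ : ℝ)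
    (n m : ℕ) (k : Fin (d + 1) → ℕ) : ℝ :=
  √n ^ d * (multinomialProb n k * normForm R μ (empirical n k) ^ m)

/-- The deviation of the counts `k` from their mean, scaled by `√n`. -/
noncomputable def deviation {d : ℕ} (n : ℕ) (k : Fin (d + 1) → ℕ) (i : Fin (d + 1)) : ℝ :=
  (k i - n * (1 / (d + 1))) / √n

theorem empirical_eq_deviation {d n : ℕ} (hn : n ≠ 0) (k : Fin (d + 1) → ℕ) :
    empirical n k = fun i => 1 / (d + 1) + deviation n k i / √n := by
  have hn' : (0 : ℝ) < n := by exact_mod_cast Nat.pos_of_ne_zero hn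
  ext i
  rw [deviation, div_div, Real.mul_self_sqrt hn'.le, empirical]
  field_simp
  ring

theorem sum_deviation {d n : ℕ} {k : Fin (d + 1) → ℕ} (hk : ∑ i, k i = n) :
    ∑ i, deviation n k i = 0 := by
  simp only [deviation]
  rw [← Finset.sum_div, Finset.sum_sub_distrib, ← Nat.cast_sum, hk]
  simp
  left
  field_simp
  simp

/-- The local limit theorem: the scaled weights converge to a Gaussian density when the scaled
deviations converge to `z`. -/
theorem tendsto_scaledWeight {d : ℕ} {R : Matrix (Fin (d + 1)) (Fin (d + 1)) ℝ}
    (hR : R.IsSymm) {μ : ℝ} (hμ : 0 < μ) (hrow : R *ᵥ (fun _ => 1) = fun _ => μ)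
    {n m : ℕ → ℕ} (hn : Tendsto n atTop atTop) {c : ℝ}
    (hm : Tendsto (fun j => (m j : ℝ) / n j) atTop (𝓝 c)) {k : ℕ → Fin (d + 1) → ℕ}
    (hk : ∀ᶠ j in atTop, ∑ i, k j i = n j) {z : Fin (d + 1) → ℝ}
    (hz : ∀ i, Tendsto (fun j => deviation (n j) (k j) i) atTop (𝓝 (z i))) :
    Tendsto (fun j => scaledWeight R μ (n j) (m j) (k j)) atTop
      (𝓝 ((√((d : ℝ) + 1) ^ (d + 1) / √(2 * Real.pi) ^ d) *
        Real.exp (-(1 / 2) * ((d + 1) * (∑ i, z i ^ 2 - 2 * c / μ * (z ⬝ᵥ R *ᵥ z)))))) := by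
  have hN : Tendsto (fun j => (n j : ℝ)) atTop atTop := tendsto_natCast_atTop_atTop.comp hn
  have hsum : ∀ᶠ j in atTop, ∑ i, deviation (n j) (k j) i = 0 :=
    hk.mono fun j hj => sum_deviation hj
  have hn0 : ∀ᶠ j in atTop, n j ≠ 0 := hn.eventually_ne_atTop 0
  have h1 := tendsto_mul_relEntropy hN hsum hz
  obtain ⟨ε, hε0, hε1, hε2⟩ := exists_normForm_expansion hR hμ hrow hN hsum hz
  have hmε : Tendsto (fun j => (m j : ℝ) * ε j) atTop (𝓝 (c * ((d + 1) / μ * (z ⬝ᵥ R *ᵥ z)))) := by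
    refine (hm.mul hε1).congr' ?_
    filter_upwards [hN.eventually_gt_atTop 0] with j hj
    field_simp
  have h2 := tendsto_mul_log_one_add hε0 hmε
  have hemp (i) : Tendsto (fun j => empirical (n j) (k j) i) atTop (𝓝 (1 / ((d : ℝ) + 1))) := by
    have := (tendsto_div_sqrt_zero hN (hz i)).const_add (1 / ((d : ℝ) + 1))
    rw [add_zero] at this
    refine this.congr' ?_
    filter_upwards [hn0] with j hj
    rw [empirical_eq_deviation hj]
  have hkinf (i) : Tendsto (fun j => k j i) atTop atTop := by
    rw [← tendsto_natCast_atTop_iff (R := ℝ)]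
    refine (hN.atTop_mul_pos (C := 1 / ((d : ℝ) + 1)) (by positivity) (hemp i)).congr' ?_
    filter_upwards [hN.eventually_gt_atTop 0] with j hj
    rw [empirical]
    field_simp
  have hst := Stirling.tendsto_stirlingSeq_sqrt_pi
  have hpi := Real.pi_pos
  have h3 : Tendsto (fun j => √2 * Stirling.stirlingSeq (n j) /
        ∏ i, (Stirling.stirlingSeq (k j i) * √(2 * empirical (n j) (k j) i))) atTop
      (𝓝 (√2 * √Real.pi / ∏ _i : Fin (d + 1), (√Real.pi * √(2 * (1 / ((d : ℝ) + 1)))))) := by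
    refine ((hst.comp hn).const_mul _).div (tendsto_finsetProd _ fun i _ => ?_) ?_
    · exact (hst.comp (hkinf i)).mul (((hemp i).const_mul 2).sqrt)
    · exact Finset.prod_ne_zero_iff.2 fun i _ => by positivity
  have hconst : √2 * √Real.pi / ∏ _i : Fin (d + 1), (√Real.pi * √(2 * (1 / ((d : ℝ) + 1))))
      = √((d : ℝ) + 1) ^ (d + 1) / √(2 * Real.pi) ^ d := by
    rw [Finset.prod_const, Finset.card_univ, Fintype.card_fin, ← Real.sqrt_mul (by norm_num),
      ← Real.sqrt_mul hpi.le,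
      show Real.pi * (2 * (1 / ((d : ℝ) + 1))) = 2 * Real.pi / (d + 1) by ring,
      Real.sqrt_div (by positivity), div_pow, pow_succ (√(2 * Real.pi))]
    field_simp
  rw [hconst] at h3
  have h4 := (Real.continuous_exp.tendsto _).comp h1.neg
  have h5 := (Real.continuous_exp.tendsto _).comp h2
  have h6 := (h4.mul h3).mul h5
  have hlim : Real.exp (-((d + 1) / 2 * ∑ i, z i ^ 2)) *
      (√((d : ℝ) + 1) ^ (d + 1) / √(2 * Real.pi) ^ d) *
        Real.exp (c * ((d + 1) / μ * (z ⬝ᵥ R *ᵥ z)))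
      = (√((d : ℝ) + 1) ^ (d + 1) / √(2 * Real.pi) ^ d) *
        Real.exp (-(1 / 2) * ((d + 1) * (∑ i, z i ^ 2 - 2 * c / μ * (z ⬝ᵥ R *ᵥ z)))) := by
    rw [mul_comm (Real.exp _) (_ / _), mul_assoc, ← Real.exp_add]
    congr 2
    ring
  rw [hlim] at h6
  refine h6.congr' ?_
  filter_upwards [hk, hn0, hε2, hε0.eventually_const_lt (u := -1) (by norm_num),
    eventually_all.2 fun i => (hkinf i).eventually_ne_atTop 0] with j hj1 hj2 hj3 hj4 hj5
  have hpos : 0 < 1 + ε j := by linarith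
  simp only [Function.comp_apply]
  rw [scaledWeight, ← mul_assoc, sqrt_pow_mul_multinomialProb hj1 hj5, empirical_eq_deviation hj2,
    hj3, ← Real.exp_log (pow_pos hpos (m j)), Real.log_pow]

/-! ### The partition function as an integral -/

/-- The sum of the contributions of all vectors of counts: the expectation of the `m`-th power of
`normForm` under the multinomial distribution. -/
noncomputable def partitionSum {d : ℕ} (R : Matrix (Fin (d + 1)) (Fin (d + 1)) ℝ) (μ : ℝ)
    (n m : ℕ) : ℝ :=
  ∑ k ∈ Finset.piAntidiag Finset.univ n, multinomialProb n k * normForm R μ (empirical n k) ^ m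

/-- The cell, of side `1 / √n`, of the scaled deviations of `k`, in the first `d` coordinates. -/
noncomputable def cell {d : ℕ} (n : ℕ) (k : Fin (d + 1) → ℕ) : Set (Fin d → ℝ) :=
  Set.univ.pi fun i => Set.Ico (deviation n k i.castSucc) (deviation n k i.castSucc + 1 / √n)

/-- The function on `ℝ^d` that is constant on each cell, with the scaled weight as its value. -/
noncomputable def stepFunction {d : ℕ} (R : Matrix (Fin (d + 1)) (Fin (d + 1)) ℝ) (μ : ℝ)
    (n m : ℕ) (u : Fin d → ℝ) : ℝ :=
  ∑ k ∈ Finset.piAntidiag Finset.univ n, (cell n k).indicator (fun _ => scaledWeight R μ n m k) u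

theorem measurableSet_cell {d : ℕ} (n : ℕ) (k : Fin (d + 1) → ℕ) : MeasurableSet (cell n k) :=
  MeasurableSet.univ_pi fun _ => measurableSet_Ico

theorem volume_cell {d n : ℕ} (k : Fin (d + 1) → ℕ) :
    volume (cell n k) = ENNReal.ofReal ((1 / √n) ^ d) := by
  rw [cell, Real.volume_pi_Ico]
  simp only [add_sub_cancel_left, Finset.prod_const, Finset.card_univ, Fintype.card_fin]
  rw [ENNReal.ofReal_pow (by positivity)]

theorem integral_stepFunction {d : ℕ} (R : Matrix (Fin (d + 1)) (Fin (d + 1)) ℝ) (μ : ℝ)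
    {n : ℕ} (m : ℕ) (hn : n ≠ 0) : ∫ u, stepFunction R μ n m u = partitionSum R μ n m := by
  have hn' : (0 : ℝ) < n := by exact_mod_cast Nat.pos_of_ne_zero hn
  have hs := Real.sqrt_pos.2 hn'
  unfold stepFunction partitionSum
  rw [integral_finsetSum]
  · refine Finset.sum_congr rfl fun k _ => ?_
    rw [integral_indicator_const _ (measurableSet_cell n k), Measure.real, volume_cell,
      ENNReal.toReal_ofReal (by positivity), scaledWeight, smul_eq_mul, ← mul_assoc, ← mul_pow,
      one_div_mul_cancel hs.ne', one_pow, one_mul]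
  · intro k _
    refine (integrable_indicator_iff (measurableSet_cell n k)).2 (integrableOn_const ?_)
    rw [volume_cell]
    exact ENNReal.ofReal_ne_top

theorem mem_cell_iff {d n : ℕ} (hn : n ≠ 0) {k : Fin (d + 1) → ℕ} {u : Fin d → ℝ}
    (hu : ∀ i, 0 ≤ √n * u i + n * (1 / ((d : ℝ) + 1))) :
    u ∈ cell n k ↔ ∀ i, k i.castSucc = ⌊√n * u i + n * (1 / ((d : ℝ) + 1))⌋₊ := by
  have hn' : (0 : ℝ) < n := by exact_mod_cast Nat.pos_of_ne_zero hn
  have hs := Real.sqrt_pos.2 hn'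
  simp only [cell, Set.mem_univ_pi, Set.mem_Ico, deviation]
  refine forall_congr' fun i => ?_
  rw [eq_comm, Nat.floor_eq_iff (hu i), div_le_iff₀ hs, ← add_div, lt_div_iff₀ hs]
  constructor <;> rintro ⟨h1, h2⟩ <;> constructor <;> linarith

theorem nonneg_of_mem_cell {d n : ℕ} (hn : n ≠ 0) {k : Fin (d + 1) → ℕ} {u : Fin d → ℝ}
    (hu : u ∈ cell n k) (i : Fin d) : 0 ≤ √n * u i + n * (1 / ((d : ℝ) + 1)) := by
  have hn' : (0 : ℝ) < n := by exact_mod_cast Nat.pos_of_ne_zero hn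
  have h1 := (hu i (Set.mem_univ i)).1
  rw [deviation, div_le_iff₀ (Real.sqrt_pos.2 hn')] at h1
  have : (0 : ℝ) ≤ k i.castSucc := by positivity
  linarith

/-- The cells are disjoint. -/
theorem stepFunction_eq {d : ℕ} (R : Matrix (Fin (d + 1)) (Fin (d + 1)) ℝ) (μ : ℝ)
    {n : ℕ} (m : ℕ) (hn : n ≠ 0) {k : Fin (d + 1) → ℕ} (hk : ∑ i, k i = n) {u : Fin d → ℝ}
    (hu : u ∈ cell n k) : stepFunction R μ n m u = scaledWeight R μ n m k := by
  rw [stepFunction, Finset.sum_eq_single k, Set.indicator_of_mem hu]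
  · intro k' hk' hne
    refine Set.indicator_of_notMem (fun hu' => hne ?_) _
    have hnonneg := nonneg_of_mem_cell hn hu
    rw [mem_cell_iff hn hnonneg] at hu hu'
    have hk'' : ∑ i, k' i = n := by simpa using hk'
    have hc (i : Fin d) : k' i.castSucc = k i.castSucc := (hu' i).trans (hu i).symm
    ext i
    refine Fin.lastCases ?_ hc i
    rw [Fin.sum_univ_castSucc] at hk hk''
    simp only [hc] at hk''
    omega
  · simp [hk]

theorem normForm_nonneg {d : ℕ} {R : Matrix (Fin (d + 1)) (Fin (d + 1)) ℝ}
    (hnn : ∀ i j, 0 ≤ R i j) {μ : ℝ} (hμ : 0 < μ) {x : Fin (d + 1) → ℝ} (hx : ∀ i, 0 ≤ x i) :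
    0 ≤ normForm R μ x := by
  have hRx (i) : 0 ≤ (R *ᵥ x) i := by
    simp only [Matrix.mulVec, dotProduct]
    exact Finset.sum_nonneg fun j _ => mul_nonneg (hnn i j) (hx j)
  have : 0 ≤ x ⬝ᵥ R *ᵥ x := Finset.sum_nonneg fun i _ => mul_nonneg (hx i) (hRx i)
  unfold normForm
  positivity

/-- For `m ≤ b n`, the entropy inequality at the density `c` bounds the `m`-th power of `normForm`
by a power `b / c` of the exponential rate of the multinomial probabilities. -/
theorem EntropyBound.pow_le {d : ℕ} {R : Matrix (Fin (d + 1)) (Fin (d + 1)) ℝ}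
    (hnn : ∀ i j, 0 ≤ R i j) {μ : ℝ} (hμ : 0 < μ) {c : ℝ} (hc : 0 < c) (h : EntropyBound R μ c)
    {b : ℝ} {n m : ℕ} (hm : m ≤ b * n) {x : Fin (d + 1) → ℝ} (hx : ∀ i, 0 ≤ x i)
    (hx1 : ∑ i, x i = 1) : normForm R μ x ^ m ≤ Real.exp (b / c * (n * relEntropy x)) := by
  have h0 := normForm_nonneg hnn hμ hx
  have hD := relEntropy_nonneg hx hx1
  calc normForm R μ x ^ m = (normForm R μ x ^ c) ^ ((m : ℝ) / c) := by
        rw [← Real.rpow_mul h0, mul_div_cancel₀ _ hc.ne', Real.rpow_natCast]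
    _ ≤ Real.exp (relEntropy x) ^ ((m : ℝ) / c) :=
        Real.rpow_le_rpow (Real.rpow_nonneg h0 _) (h x hx hx1) (by positivity)
    _ = Real.exp (m * relEntropy x / c) := by
        rw [← Real.exp_mul]
        congr 1
        ring
    _ ≤ _ := by
        rw [Real.exp_le_exp, div_mul_eq_mul_div, ← mul_assoc]
        gcongr

theorem sum_sq_le_of_mem_cell {d n : ℕ} (hn : n ≠ 0) {k : Fin (d + 1) → ℕ} {u : Fin d → ℝ}
    (hu : u ∈ cell n k) : ∑ i, u i ^ 2 ≤ 2 * ∑ i, deviation n k i ^ 2 + 2 * d := by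
  have hn1 : (1 : ℝ) ≤ √n := Real.one_le_sqrt.2 (by exact_mod_cast Nat.one_le_iff_ne_zero.2 hn)
  have h1 : 1 / √(n : ℝ) ≤ 1 := (div_le_one (by linarith)).2 hn1
  have h (i : Fin d) : u i ^ 2 ≤ 2 * deviation n k i.castSucc ^ 2 + 2 := by
    obtain ⟨h2, h3⟩ := hu i (Set.mem_univ i)
    nlinarith [sq_nonneg (2 * deviation n k i.castSucc - u i),
      sq_nonneg (u i - deviation n k i.castSucc)]
  refine (Finset.sum_le_sum fun i _ => h i).trans ?_
  rw [Fin.sum_univ_castSucc (fun i => deviation n k i ^ 2), Finset.sum_add_distrib,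
    ← Finset.mul_sum]
  simp
  nlinarith [sq_nonneg (deviation n k (Fin.last d))]

/-- The step functions have a common Gaussian majorant. -/
theorem exists_stepFunction_le {d : ℕ} {R : Matrix (Fin (d + 1)) (Fin (d + 1)) ℝ}
    (hnn : ∀ i j, 0 ≤ R i j) {μ : ℝ} (hμ : 0 < μ) {c : ℝ} (hc : 0 < c) (h : EntropyBound R μ c)
    {b : ℝ} (hb : b < c) : ∃ C, ∃ η > 0, ∀ (n m : ℕ) (u : Fin d → ℝ), n ≠ 0 → (m : ℝ) ≤ b * n →
      ‖stepFunction R μ n m u‖ ≤ C * Real.exp (-(η * ∑ i, u i ^ 2)) := by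
  obtain ⟨C, hC, η, hη, hbound⟩ := exists_multinomialProb_mul_exp_le d ((div_lt_one hc).2 hb)
  refine ⟨C * Real.exp (η * d), η / 2, by positivity, fun n m u hn hm => ?_⟩
  by_cases hu : ∃ k : Fin (d + 1) → ℕ, ∑ i, k i = n ∧ u ∈ cell n k
  · obtain ⟨k, hk, hu⟩ := hu
    have hn' : (0 : ℝ) < n := by exact_mod_cast Nat.pos_of_ne_zero hn
    have hx := empirical_nonneg n k
    have h0 := normForm_nonneg hnn hμ hx
    have hp := multinomialProb_nonneg n k
    rw [stepFunction_eq R μ m hn hk hu, Real.norm_of_nonneg (by unfold scaledWeight; positivity),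
      scaledWeight, mul_assoc C, ← Real.exp_add]
    refine le_trans ?_ ((hbound n k hn hk).trans ?_)
    · have := h.pow_le hnn hμ hc hm hx (sum_empirical hn hk)
      gcongr
    · have hdev : n * ∑ i, (empirical n k i - 1 / (d + 1)) ^ 2 = ∑ i, deviation n k i ^ 2 := by
        rw [Finset.mul_sum]
        refine Finset.sum_congr rfl fun i _ => ?_
        rw [empirical_eq_deviation hn, add_sub_cancel_left, div_pow, Real.sq_sqrt hn'.le]
        field_simp
      have := sum_sq_le_of_mem_cell hn hu
      rw [hdev]
      gcongr
      nlinarith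
  · have : stepFunction R μ n m u = 0 := by
      refine Finset.sum_eq_zero fun k hk => Set.indicator_of_notMem (fun hmem => hu ⟨k, ?_, hmem⟩) _
      simpa using hk
    rw [this, norm_zero]
    positivity

theorem integrable_exp_neg_mul_sum_sq (d : ℕ) {η : ℝ} (hη : 0 < η) :
    Integrable fun u : Fin d → ℝ => Real.exp (-(η * ∑ i, u i ^ 2)) := by
  have h (_ : Fin d) : Integrable (fun x : ℝ => Real.exp (-η * x ^ 2)) volume :=
    integrable_exp_neg_mul_sq hη
  have := Integrable.fintype_prod (f := fun (_ : Fin d) (x : ℝ) => Real.exp (-η * x ^ 2)) h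
  refine this.congr (Eventually.of_forall fun u => ?_)
  simp only []
  rw [← Real.exp_sum, ← Finset.mul_sum, neg_mul]

/-- The counts whose cell contains `u`. -/
noncomputable def cellCounts {d : ℕ} (n : ℕ) (u : Fin d → ℝ) : Fin (d + 1) → ℕ :=
  Fin.snoc (fun i => ⌊√n * u i + n * (1 / ((d : ℝ) + 1))⌋₊)
    (n - ∑ i, ⌊√n * u i + n * (1 / ((d : ℝ) + 1))⌋₊)

theorem eventually_cellCounts {d : ℕ} {n : ℕ → ℕ} (hn : Tendsto n atTop atTop) (u : Fin d → ℝ) :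
    ∀ᶠ j in atTop, ∑ i, cellCounts (n j) u i = n j ∧ u ∈ cell (n j) (cellCounts (n j) u) := by
  have hN : Tendsto (fun j => (n j : ℝ)) atTop atTop := tendsto_natCast_atTop_atTop.comp hn
  have hev (v : ℝ) : ∀ᶠ j in atTop, 0 ≤ √(n j : ℝ) * v + n j * (1 / ((d : ℝ) + 1)) := by
    have hs := Real.tendsto_sqrt_atTop.comp hN
    have h2 : Tendsto (fun j => v + √(n j : ℝ) * (1 / ((d : ℝ) + 1))) atTop atTop :=
      tendsto_atTop_add_const_left _ _ (hs.atTop_mul_const (by positivity))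
    filter_upwards [h2.eventually_ge_atTop 0] with j hj
    have := mul_nonneg (Real.sqrt_nonneg (n j : ℝ)) hj
    rw [mul_add, ← mul_assoc, Real.mul_self_sqrt (by positivity)] at this
    exact this
  filter_upwards [eventually_all.2 fun i => hev (u i), hev (-∑ i, u i), hn.eventually_ne_atTop 0]
    with j h1 h2 h3
  have hle : ∑ i, ⌊√(n j : ℝ) * u i + n j * (1 / ((d : ℝ) + 1))⌋₊ ≤ n j := by
    have h4 := Finset.sum_le_sum fun i (_ : i ∈ Finset.univ) => Nat.floor_le (h1 i)
    rw [Finset.sum_add_distrib, ← Finset.mul_sum] at h4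
    have h5 : ∑ _i : Fin d, (n j : ℝ) * (1 / ((d : ℝ) + 1)) = n j - n j * (1 / ((d : ℝ) + 1)) := by
      simp
      field_simp
      ring
    have h6 : ∑ i, (⌊√(n j : ℝ) * u i + n j * (1 / ((d : ℝ) + 1))⌋₊ : ℝ) ≤ n j := by linarith
    exact_mod_cast h6
  refine ⟨?_, (mem_cell_iff h3 h1).2 fun i => by simp [cellCounts]⟩
  rw [Fin.sum_univ_castSucc]
  simp only [cellCounts, Fin.snoc_castSucc, Fin.snoc_last]
  omega

theorem tendsto_deviation_cellCounts {d : ℕ} {n : ℕ → ℕ} (hn : Tendsto n atTop atTop)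
    (u : Fin d → ℝ) (i : Fin (d + 1)) :
    Tendsto (fun j => deviation (n j) (cellCounts (n j) u) i) atTop
      (𝓝 ((tangentBasis d *ᵥ u) i)) := by
  have hN : Tendsto (fun j => (n j : ℝ)) atTop atTop := tendsto_natCast_atTop_atTop.comp hn
  have hcast (i : Fin d) : Tendsto (fun j => deviation (n j) (cellCounts (n j) u) i.castSucc) atTop
      (𝓝 (u i)) := by
    have h1 := (tendsto_div_sqrt_zero hN (tendsto_const_nhds (x := (1 : ℝ)))).const_sub (u i)
    rw [sub_zero] at h1
    refine tendsto_of_tendsto_of_tendsto_of_le_of_le' h1 tendsto_const_nhds ?_ ?_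
    · filter_upwards [eventually_cellCounts hn u] with j hj
      have := (hj.2 i (Set.mem_univ i)).2
      linarith
    · filter_upwards [eventually_cellCounts hn u] with j hj
      exact (hj.2 i (Set.mem_univ i)).1
  refine Fin.lastCases ?_ (fun i => ?_) i
  · rw [tangentBasis_mulVec_last]
    refine (tendsto_finsetSum Finset.univ fun i _ => hcast i).neg.congr' ?_
    filter_upwards [eventually_cellCounts hn u] with j hj
    have := sum_deviation hj.1
    rw [Fin.sum_univ_castSucc] at this
    linarith
  · rw [tangentBasis_mulVec_castSucc]
    exact hcast i

/-- The Gaussian limit of the partition function, by dominated convergence. -/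
theorem tendsto_partitionSum {d : ℕ} {R : Matrix (Fin (d + 1)) (Fin (d + 1)) ℝ}
    (hR : R.IsSymm) (hnn : ∀ i j, 0 ≤ R i j) {μ : ℝ} (hμ : 0 < μ)
    (hrow : R *ᵥ (fun _ => 1) = fun _ => μ) {c' : ℝ} (hc' : 0 < c') (h : EntropyBound R μ c')
    {b : ℝ} (hb : b < c') {n m : ℕ → ℕ} (hn : Tendsto n atTop atTop)
    (hmb : ∀ j, (m j : ℝ) ≤ b * n j) {c : ℝ}
    (hm : Tendsto (fun j => (m j : ℝ) / n j) atTop (𝓝 c)) :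
    Tendsto (fun j => partitionSum R μ (n j) (m j)) atTop
      (𝓝 (∫ u : Fin d → ℝ, (√((d : ℝ) + 1) ^ (d + 1) / √(2 * Real.pi) ^ d) *
        Real.exp (-(1 / 2) * ((d + 1) * (∑ i, (tangentBasis d *ᵥ u) i ^ 2
          - 2 * c / μ * ((tangentBasis d *ᵥ u) ⬝ᵥ R *ᵥ (tangentBasis d *ᵥ u))))))) := by
  obtain ⟨C, η, hη, hbound⟩ := exists_stepFunction_le hnn hμ hc' h hb
  have hn0 : ∀ᶠ j in atTop, n j ≠ 0 := hn.eventually_ne_atTop 0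
  have key := tendsto_integral_filter_of_dominated_convergence (l := atTop) (μ := volume)
    (F := fun j => stepFunction R μ (n j) (m j))
    (f := fun u => (√((d : ℝ) + 1) ^ (d + 1) / √(2 * Real.pi) ^ d) *
        Real.exp (-(1 / 2) * ((d + 1) * (∑ i, (tangentBasis d *ᵥ u) i ^ 2
          - 2 * c / μ * ((tangentBasis d *ᵥ u) ⬝ᵥ R *ᵥ (tangentBasis d *ᵥ u))))))
    (fun u => C * Real.exp (-(η * ∑ i, u i ^ 2)))
    (Eventually.of_forall fun j => by
      refine (Finset.measurable_sum _ fun k _ => ?_).aestronglyMeasurable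
      exact measurable_const.indicator (measurableSet_cell _ _))
    (hn0.mono fun j hj => Eventually.of_forall fun u => hbound _ _ u hj (hmb j))
    ((integrable_exp_neg_mul_sum_sq d hη).const_mul C)
    (Eventually.of_forall fun u => by
      have hev := eventually_cellCounts hn u
      refine (tendsto_scaledWeight hR hμ hrow hn hm (hev.mono fun j hj => hj.1)
        (tendsto_deviation_cellCounts hn u)).congr' ?_
      filter_upwards [hev, hn0] with j hj hj0
      exact (stepFunction_eq R μ (m j) hj0 hj.1 hj.2).symm)
  exact key.congr' (hn0.mono fun j hj => integral_stepFunction R μ (m j) hj)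

/-! ### Eigenvalues and the critical density -/

theorem exists_pos_of_isIrreducible {d : ℕ} {R : Matrix (Fin (d + 1)) (Fin (d + 1)) ℝ}
    (h : R.IsIrreducible) : ∃ i j, 0 < R i j := by
  by_contra! hle
  have h0 : R = 0 := by
    ext i j
    exact le_antisymm (hle i j) (h.nonneg i j)
  obtain ⟨k, hk, hpos⟩ := (Matrix.isIrreducible_iff_exists_pow_pos h.nonneg).1 h 0 0
  rw [h0, zero_pow hk.ne'] at hpos
  simp at hpos

/-- For a non-negative matrix with constant row sums, the row sum is the largest eigenvalue. -/
theorem mulVec_one_eq_largest {d : ℕ} {R : Matrix (Fin (d + 1)) (Fin (d + 1)) ℝ}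
    (hnn : ∀ i j, 0 ≤ R i j) {lam : Fin (d + 1) → ℝ} (hlam : Antitone lam)
    (hroots : R.charpoly.roots = Finset.univ.val.map lam)
    (hone : ∃ μ : ℝ, Module.End.HasEigenvector (Matrix.toLin' R) μ (fun _ => 1)) :
    R *ᵥ (fun _ => 1) = fun _ => lam 0 := by
  obtain ⟨μ, hμ⟩ := hone
  have hrow : R *ᵥ (fun _ => 1) = fun _ => μ := by
    have := hμ.apply_eq_smul
    rw [Matrix.toLin'_apply] at this
    rw [this]
    ext
    simp
  have hroot (x : ℝ) : Module.End.HasEigenvalue (Matrix.toLin' R) x ↔ ∃ i, lam i = x := by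
    rw [Module.End.hasEigenvalue_iff_isRoot_charpoly, Matrix.charpoly_toLin',
      ← Polynomial.mem_roots R.charpoly_monic.ne_zero, hroots, Multiset.mem_map]
    simp only [Finset.mem_val, Finset.mem_univ, true_and]
  obtain ⟨i, hi⟩ := (hroot μ).1 (Module.End.hasEigenvalue_of_hasEigenvector hμ)
  have hle : μ ≤ lam 0 := hi ▸ hlam (Fin.zero_le i)
  obtain ⟨v, hv⟩ := ((hroot (lam 0)).2 ⟨0, rfl⟩).exists_hasEigenvector
  have hv1 : R *ᵥ v = lam 0 • v := by simpa using hv.apply_eq_smul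
  obtain ⟨p, -, hp⟩ := Finset.exists_max_image Finset.univ (fun i => |v i|) ⟨0, Finset.mem_univ _⟩
  have hvp : 0 < |v p| := by
    refine abs_pos.2 fun h0 => hv.2 ?_
    ext j
    have := hp j (Finset.mem_univ j)
    rw [h0, abs_zero] at this
    exact abs_eq_zero.1 (le_antisymm this (abs_nonneg _))
  have hge : lam 0 * |v p| ≤ μ * |v p| := by
    have h1 : lam 0 * v p = ∑ j, R p j * v j := (congrFun hv1 p).symm
    have h2 : μ = ∑ j, R p j := by
      have := congrFun hrow p
      simpa [Matrix.mulVec, dotProduct] using this.symm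
    calc lam 0 * |v p| ≤ |lam 0 * v p| := by
          rw [abs_mul]
          exact mul_le_mul_of_nonneg_right (le_abs_self _) hvp.le
      _ ≤ ∑ j, |R p j * v j| := h1 ▸ Finset.abs_sum_le_sum_abs _ _
      _ ≤ ∑ j, R p j * |v p| := Finset.sum_le_sum fun j _ => by
          rw [abs_mul, abs_of_nonneg (hnn p j)]
          exact mul_le_mul_of_nonneg_left (hp j (Finset.mem_univ j)) (hnn p j)
      _ = μ * |v p| := by rw [← Finset.sum_mul, ← h2]
  rw [hrow, le_antisymm hle (le_of_mul_le_mul_right hge hvp)]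

theorem rowSum_pos {d : ℕ} {R : Matrix (Fin (d + 1)) (Fin (d + 1)) ℝ}
    (hnn : ∀ i j, 0 ≤ R i j) (hpos : ∃ i j, 0 < R i j) {μ : ℝ}
    (hrow : R *ᵥ (fun _ => 1) = fun _ => μ) : 0 < μ := by
  obtain ⟨i, j, hij⟩ := hpos
  have h : ∑ j, R i j = μ := by
    have := congrFun hrow i
    simpa [Matrix.mulVec, dotProduct] using this
  exact h ▸ Finset.sum_pos' (fun j _ => hnn i j) ⟨j, Finset.mem_univ j, hij⟩

theorem dotProduct_one_sub_smul {n : Type*} [Fintype n] [DecidableEq n] (R : Matrix n n ℝ) (s : ℝ)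
    (z : n → ℝ) : z ⬝ᵥ (1 - s • R) *ᵥ z = ∑ i, z i ^ 2 - s * (z ⬝ᵥ R *ᵥ z) := by
  rw [Matrix.sub_mulVec, Matrix.one_mulVec, Matrix.smul_mulVec, dotProduct_sub, dotProduct_smul,
    smul_eq_mul]
  simp [dotProduct, sq]

theorem one_sub_smul_isSymm {n : Type*} [DecidableEq n] {R : Matrix n n ℝ} (hR : R.IsSymm)
    (s : ℝ) : (1 - s • R).IsSymm := by
  simp [Matrix.IsSymm, hR.eq]

section Spectrum

variable {d : ℕ} {R : Matrix (Fin (d + 1)) (Fin (d + 1)) ℝ} {lam : Fin (d + 1) → ℝ}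

theorem EntropyBound.posDef (hR : R.IsSymm) {μ : ℝ} (hμ : 0 < μ)
    (hrow : R *ᵥ (fun _ => 1) = fun _ => μ) {c : ℝ} (h : EntropyBound R μ c) {s : ℝ} (hs0 : 0 ≤ s)
    (hs : s < 2 * c / μ) : ((tangentBasis d)ᵀ * (1 - s • R) * tangentBasis d).PosDef := by
  refine posDef_conj_tangentBasis (one_sub_smul_isSymm hR s) fun z hz hz0 => ?_
  rw [dotProduct_one_sub_smul]
  have hpos : 0 < ∑ i, z i ^ 2 := by
    obtain ⟨k, hk⟩ := Function.ne_iff.1 hz0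
    exact Finset.sum_pos' (fun k _ => sq_nonneg _) ⟨k, Finset.mem_univ k, sq_pos_of_ne_zero hk⟩
  have hq := h.quadratic_le hR hμ hrow hz
  rcases le_or_gt (z ⬝ᵥ R *ᵥ z) 0 with h0 | h0
  · nlinarith
  · nlinarith

/-- Below the critical density, all factors of the asymptotic formula are positive: a zero
`s = 1 / λ_i` of the determinant cannot occur where the form `1 - s R` is positive definite. -/
theorem EntropyBound.factor_pos (hR : R.IsSymm)
    (hroots : R.charpoly.roots = Finset.univ.val.map lam) (hμ : 0 < lam 0)
    (hrow : R *ᵥ (fun _ => 1) = fun _ => lam 0) {c' : ℝ} (h : EntropyBound R (lam 0) c') {c : ℝ}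
    (hc0 : 0 ≤ c) (hc : c < c') {i : Fin (d + 1)} (hi : i ≠ 0) :
    0 < 1 - 2 * (lam i / lam 0) * c := by
  rcases le_or_gt (lam i) 0 with hle | hgt
  · have : lam i / lam 0 ≤ 0 := div_nonpos_of_nonpos_of_nonneg hle hμ.le
    nlinarith
  by_contra! hcon
  have h1 : (lam i)⁻¹ < 2 * c' / lam 0 := by
    have h2 : 1 ≤ 2 * (lam i / lam 0) * c := by linarith
    have h3 : lam 0 ≤ 2 * c * lam i := by
      have := mul_le_mul_of_nonneg_right h2 hμ.le
      field_simp at this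
      linarith
    rw [inv_eq_one_div, div_lt_div_iff₀ hgt hμ]
    nlinarith
  have hdet := (h.posDef hR hμ hrow (inv_nonneg.2 hgt.le) h1).det_pos
  rw [det_conj_one_sub_smul hR hroots hrow, Finset.prod_eq_zero
    (Finset.mem_erase.2 ⟨hi, Finset.mem_univ i⟩) (by rw [inv_mul_cancel₀ hgt.ne', sub_self]),
    mul_zero] at hdet
  exact hdet.false

/-- If no eigenvalue other than the first is positive, then `R` is negative semidefinite on the
vectors with sum zero, and the entropy inequality holds for every density. -/
theorem entropyBound_of_nonpos (hR : R.IsSymm) (hnn : ∀ i j, 0 ≤ R i j)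
    (hroots : R.charpoly.roots = Finset.univ.val.map lam) (hμ : 0 < lam 0)
    (hrow : R *ᵥ (fun _ => 1) = fun _ => lam 0) (hneg : ∀ i ≠ 0, lam i ≤ 0) {c : ℝ} (hc : 0 < c) :
    EntropyBound R (lam 0) c := by
  have hpd (s : ℝ) (hs : 0 ≤ s) : ((tangentBasis d)ᵀ * (1 - s • R) * tangentBasis d).PosDef := by
    refine posDef_of_isPreconnected (S := Set.Ici (0 : ℝ)) isPreconnected_Ici
      (A := fun s => (tangentBasis d)ᵀ * (1 - s • R) * tangentBasis d) (x₀ := 0) (by fun_prop)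
      (fun s _ => isHermitian_conj_tangentBasis (one_sub_smul_isSymm hR s)) (fun s hs => ?_)
      Set.self_mem_Ici ?_ hs
    · rw [det_conj_one_sub_smul hR hroots hrow]
      refine mul_ne_zero (by positivity) (Finset.prod_ne_zero_iff.2 fun i hi => ?_)
      have := hneg i (Finset.ne_of_mem_erase hi)
      have hs' : (0 : ℝ) ≤ s := hs
      nlinarith
    · refine posDef_conj_tangentBasis (one_sub_smul_isSymm hR 0) fun z hz hz0 => ?_
      rw [dotProduct_one_sub_smul, zero_mul, sub_zero]
      obtain ⟨k, hk⟩ := Function.ne_iff.1 hz0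
      exact Finset.sum_pos' (fun k _ => sq_nonneg _) ⟨k, Finset.mem_univ k, sq_pos_of_ne_zero hk⟩
  have hquad (z : Fin (d + 1) → ℝ) (hz : ∑ i, z i = 0) : z ⬝ᵥ R *ᵥ z ≤ 0 := by
    by_contra! hcon
    obtain ⟨u, rfl⟩ := exists_tangentBasis_mulVec_eq hz
    set z := tangentBasis d *ᵥ u
    set s := (∑ i, z i ^ 2 + 1) / (z ⬝ᵥ R *ᵥ z) with hs
    have hs0 : 0 ≤ s := by positivity
    have h1 := (hpd s hs0).posSemidef.dotProduct_mulVec_nonneg u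
    rw [star_trivial, dotProduct_conj_tangentBasis, dotProduct_one_sub_smul, hs,
      div_mul_cancel₀ _ hcon.ne'] at h1
    linarith
  intro x hx hx1
  have hsum : ∑ i, (x i - 1 / ((d : ℝ) + 1)) = 0 := by
    rw [Finset.sum_sub_distrib, hx1, (barycentre_mem_openSimplex d).2, sub_self]
  have h1 := normForm_barycentre_add hR hμ hrow hsum
  simp only [add_sub_cancel] at h1
  have h2 : normForm R (lam 0) x ≤ 1 := by
    rw [h1]
    have := mul_nonpos_of_nonneg_of_nonpos (show 0 ≤ ((d : ℝ) + 1) / lam 0 by positivity)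
      (hquad _ hsum)
    linarith
  exact (Real.rpow_le_one (normForm_nonneg hnn hμ hx) h2 hc.le).trans
    (Real.one_le_exp (relEntropy_nonneg hx hx1))

/-! ### The asymptotic formula -/

theorem integral_limit (hR : R.IsSymm) (hroots : R.charpoly.roots = Finset.univ.val.map lam)
    (hμ : 0 < lam 0) (hrow : R *ᵥ (fun _ => 1) = fun _ => lam 0) {c' : ℝ}
    (h : EntropyBound R (lam 0) c') {c : ℝ} (hc0 : 0 ≤ c) (hc : c < c') :
    ∫ u : Fin d → ℝ, (√((d : ℝ) + 1) ^ (d + 1) / √(2 * Real.pi) ^ d) *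
        Real.exp (-(1 / 2) * ((d + 1) * (∑ i, (tangentBasis d *ᵥ u) i ^ 2
          - 2 * c / lam 0 * ((tangentBasis d *ᵥ u) ⬝ᵥ R *ᵥ (tangentBasis d *ᵥ u)))))
      = ∏ i ∈ Finset.univ.erase 0, (1 - 2 * (lam i / lam 0) * c) ^ (-(1 / 2) : ℝ) := by
  have hd : (0 : ℝ) < d + 1 := by positivity
  have hfac (i) (hi : i ∈ Finset.univ.erase (0 : Fin (d + 1))) :=
    h.factor_pos hR hroots hμ hrow hc0 hc (Finset.ne_of_mem_erase hi)
  set P := ∏ i ∈ Finset.univ.erase 0, (1 - 2 * (lam i / lam 0) * c) with hP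
  have hP0 : 0 < P := Finset.prod_pos hfac
  have hM := (h.posDef hR hμ hrow (s := 2 * c / lam 0) (by positivity) (by gcongr)).smul hd
  have hquad (u : Fin d → ℝ) : (d + 1) * (∑ i, (tangentBasis d *ᵥ u) i ^ 2
      - 2 * c / lam 0 * ((tangentBasis d *ᵥ u) ⬝ᵥ R *ᵥ (tangentBasis d *ᵥ u)))
      = u ⬝ᵥ (((d : ℝ) + 1) •
        ((tangentBasis d)ᵀ * (1 - (2 * c / lam 0) • R) * tangentBasis d)) *ᵥ u := by
    rw [Matrix.smul_mulVec, dotProduct_smul, dotProduct_conj_tangentBasis, dotProduct_one_sub_smul,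
      smul_eq_mul]
  simp_rw [hquad]
  have hdet : (((d : ℝ) + 1) •
      ((tangentBasis d)ᵀ * (1 - (2 * c / lam 0) • R) * tangentBasis d)).det
      = ((d : ℝ) + 1) ^ (d + 1) * P := by
    rw [Matrix.det_smul, det_conj_one_sub_smul hR hroots hrow, Fintype.card_fin, ← mul_assoc,
      ← pow_succ, hP]
    congr 1
    exact Finset.prod_congr rfl fun i _ => by ring
  have hsqrt : √(((d : ℝ) + 1) ^ (d + 1)) = √((d : ℝ) + 1) ^ (d + 1) := by
    rw [Real.sqrt_eq_iff_mul_self_eq (by positivity) (by positivity), ← mul_pow,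
      Real.mul_self_sqrt hd.le]
  rw [integral_const_mul, integral_exp_neg_half_quadratic hM, hdet,
    Real.sqrt_mul (x := ((d : ℝ) + 1) ^ (d + 1)) (by positivity), hsqrt,
    Real.finsetProd_rpow _ _ fun i hi => (hfac i hi).le, Real.rpow_neg hP0.le,
    ← Real.sqrt_eq_rpow]
  have := Real.pi_pos
  field_simp

theorem tendsto_prod_factors (hR : R.IsSymm) (hroots : R.charpoly.roots = Finset.univ.val.map lam)
    (hμ : 0 < lam 0) (hrow : R *ᵥ (fun _ => 1) = fun _ => lam 0) {c' : ℝ}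
    (h : EntropyBound R (lam 0) c') {c : ℝ} (hc0 : 0 ≤ c) (hc : c < c') {x : ℕ → ℝ}
    (hx : Tendsto x atTop (𝓝 c)) :
    Tendsto (fun j => ∏ i ∈ Finset.univ.erase 0, (1 - 2 * (lam i / lam 0) * x j) ^ (-(1 / 2) : ℝ))
      atTop (𝓝 (∏ i ∈ Finset.univ.erase 0, (1 - 2 * (lam i / lam 0) * c) ^ (-(1 / 2) : ℝ))) :=
  tendsto_finsetProd _ fun _ hi => ((hx.const_mul _).const_sub 1).rpow_const
    (Or.inl (h.factor_pos hR hroots hμ hrow hc0 hc (Finset.ne_of_mem_erase hi)).ne')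

theorem numGraphs_div_asymptoticValue (hR : R.IsSymm) (hμ : 0 < lam 0) {n : ℕ} (hn : n ≠ 0)
    (m : ℕ) : numGraphs R hR (fun _ => 1) n m / asymptoticValue lam n m
      = partitionSum R (lam 0) n m /
        ∏ i ∈ Finset.univ.erase 0, (1 - 2 * (lam i / lam 0) * (m / n)) ^ (-(1 / 2) : ℝ) := by
  have hn' : (0 : ℝ) < n := by exact_mod_cast Nat.pos_of_ne_zero hn
  have hd : (0 : ℝ) < d + 1 := by positivity
  have hk (k : Fin (d + 1) → ℕ) : multinomialProb n k * normForm R (lam 0) (empirical n k) ^ m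
      = (Nat.multinomial Finset.univ k : ℝ) * ((fun i => (k i : ℝ)) ⬝ᵥ R *ᵥ fun i => (k i : ℝ)) ^ m
        * (((d : ℝ) + 1) ^ m / ((d + 1) ^ n * (lam 0 ^ m * n ^ (2 * m)))) := by
    have h : empirical n k = (n : ℝ)⁻¹ • fun i => (k i : ℝ) := by
      ext i
      simp [empirical, div_eq_inv_mul]
    rw [multinomialProb, normForm, h, Matrix.mulVec_smul, dotProduct_smul, smul_dotProduct,
      smul_smul, smul_eq_mul, mul_pow, mul_pow, div_pow, ← mul_inv, inv_pow, ← sq, ← pow_mul]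
    field_simp
  rw [numGraphs_eq_sum_multinomial, asymptoticValue, partitionSum,
    Finset.sum_congr rfl fun k _ => hk k,
    ← Finset.sum_mul, zpow_sub₀ (by exact_mod_cast Nat.succ_ne_zero d), zpow_natCast, zpow_natCast]
  push_cast
  rw [← div_div]
  congr 1
  have : (0 : ℝ) < m.factorial := by exact_mod_cast m.factorial_pos
  field_simp

/-- The asymptotic formula, given the entropy inequality for some density above `b`. A failure of
uniformity would give sequences with `m / n → c`, along which the partition function converges. -/
theorem equivalentOn_of_entropyBound (hR : R.IsSymm) (hnn : ∀ i j, 0 ≤ R i j)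
    (hroots : R.charpoly.roots = Finset.univ.val.map lam)
    (hμ : 0 < lam 0) (hrow : R *ᵥ (fun _ => 1) = fun _ => lam 0) {c' : ℝ} (hc' : 0 < c')
    (h : EntropyBound R (lam 0) c') {a b : ℝ} (ha : 0 < a) (hb : b < c') :
    EquivalentOn (numGraphs R hR (fun _ => 1)) (asymptoticValue lam) a b := by
  intro ε hε
  by_contra! hcon
  choose n m hn hmem hfar using hcon
  have hn0 (j) : n j ≠ 0 := by
    intro h0
    have := (hmem j).1
    rw [h0, Nat.cast_zero, div_zero] at this
    linarith
  have hninf : Tendsto n atTop atTop := tendsto_atTop_mono hn tendsto_id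
  obtain ⟨c, hc, φ, hφ, hlim⟩ := isCompact_Icc.tendsto_subseq hmem
  have hc0 : 0 ≤ c := ha.le.trans hc.1
  have hcc : c < c' := hc.2.trans_lt hb
  have h1 := tendsto_partitionSum hR hnn hμ hrow hc' h hb (n := n ∘ φ) (m := m ∘ φ)
    (hninf.comp hφ.tendsto_atTop) (fun j => by
      have hpos : (0 : ℝ) < n (φ j) := by exact_mod_cast Nat.pos_of_ne_zero (hn0 _)
      exact (div_le_iff₀ hpos).1 (hmem (φ j)).2) hlim
  rw [integral_limit hR hroots hμ hrow h hc0 hcc] at h1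
  have h2 := tendsto_prod_factors hR hroots hμ hrow h hc0 hcc hlim
  have hpos : 0 < ∏ i ∈ Finset.univ.erase 0, (1 - 2 * (lam i / lam 0) * c) ^ (-(1 / 2) : ℝ) :=
    Finset.prod_pos fun i hi => Real.rpow_pos_of_pos
      (h.factor_pos hR hroots hμ hrow hc0 hcc (Finset.ne_of_mem_erase hi)) _
  have h3 := ((h1.div h2 hpos.ne').sub_const 1).abs
  rw [div_self hpos.ne', sub_self, abs_zero] at h3
  obtain ⟨j, hj⟩ := (h3.eventually_lt_const hε).exists
  have := hfar (φ j)
  rw [numGraphs_div_asymptoticValue hR hμ (hn0 _)] at this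
  exact absurd hj this.not_gt

end Spectrum

end InhomGraph

theorem mainTheorem3 {q : ℕ} [NeZero q] (R : Matrix (Fin q) (Fin q) ℝ)
    (hsymm : R.IsSymm) (hirr : R.IsIrreducible)
    (lam : Fin q → ℝ) (hlam : Antitone lam)
    (hroots : R.charpoly.roots = Finset.univ.val.map lam)
    (hone : ∃ μ : ℝ, Module.End.HasEigenvector (Matrix.toLin' R) μ (fun _ => 1)) :
    (∀ a b : ℝ, 0 < a → (b : EReal) < InhomGraph.beta R →
      InhomGraph.EquivalentOn (InhomGraph.numGraphs R hsymm (fun _ => 1))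
        (InhomGraph.asymptoticValue lam) a b) ∧
    (∀ h : 1 < q, 0 < lam ⟨1, h⟩ →
      InhomGraph.beta R ≤ ((lam 0 / (2 * lam ⟨1, h⟩) : ℝ) : EReal)) ∧
    ((∀ h : 1 < q, lam ⟨1, h⟩ ≤ 0) →
      ∀ a b : ℝ, 0 < a →
        InhomGraph.EquivalentOn (InhomGraph.numGraphs R hsymm (fun _ => 1))
          (InhomGraph.asymptoticValue lam) a b) := by
  open InhomGraph in
  obtain ⟨d, rfl⟩ : ∃ d, q = d + 1 := Nat.exists_eq_succ_of_ne_zero (NeZero.ne q)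
  have hnn := hirr.nonneg
  have hpos := exists_pos_of_isIrreducible hirr
  have hrow := mulVec_one_eq_largest hnn hlam hroots hone
  have hμ := rowSum_pos hnn hpos hrow
  have hbound {c : ℝ} (hc : 0 < c) (hdet : ∀ x ∈ openSimplex (d + 1), 0 < (hessian R c x).det) :
      EntropyBound R (lam 0) c := entropyBound_of_det_pos hsymm hnn hpos hμ hrow hc hdet
  refine ⟨fun a b ha hb => ?_, fun h hlam1 => ?_, fun hneg a b ha => ?_⟩
  · obtain ⟨_, ⟨c, hdet, rfl⟩, hbc⟩ := lt_sSup_iff.1 hb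
    rw [EReal.coe_lt_coe_iff] at hbc
    rcases le_or_gt c 0 with hc | hc
    · -- No `m / n` lies in `[a, b]`, because `b < 0 < a`.
      intro ε _
      exact ⟨0, fun n m _ hmem => absurd (hmem.1.trans hmem.2) (by linarith)⟩
    · exact equivalentOn_of_entropyBound hsymm hnn hroots hμ hrow hc (hbound hc hdet) ha hbc
  · refine sSup_le ?_
    rintro _ ⟨c, hdet, rfl⟩
    rw [EReal.coe_le_coe_iff]
    have hcrit : 0 < lam 0 / (2 * lam ⟨1, h⟩) := by positivity
    rcases le_or_gt c 0 with hc | hc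
    · exact hc.trans hcrit.le
    by_contra! hlt
    have := (hbound hc hdet).factor_pos hsymm hroots hμ hrow hcrit.le hlt (i := ⟨1, h⟩)
      (by simp [Fin.ext_iff])
    have heq : 2 * (lam ⟨1, h⟩ / lam 0) * (lam 0 / (2 * lam ⟨1, h⟩)) = 1 := by field_simp
    linarith
  · have hneg' (i : Fin (d + 1)) (hi : i ≠ 0) : lam i ≤ 0 := by
      have hi1 : 1 ≤ (i : ℕ) := Nat.one_le_iff_ne_zero.2 fun h0 => hi (Fin.ext h0)
      exact (hlam (show (⟨1, by omega⟩ : Fin (d + 1)) ≤ i from hi1)).trans (hneg (by omega))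
    have hc : 0 < |b| + 1 := by positivity
    exact equivalentOn_of_entropyBound hsymm hnn hroots hμ hrow hc
      (entropyBound_of_nonpos hsymm hnn hroots hμ hrow hneg' hc) ha
      ((le_abs_self b).trans_lt (lt_add_one _))
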